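/- Let $\alpha\ge -\tfrac12$ and let $P_n^{(\alpha)}$ ($n\ge 0$) be the Gegenbauer polynomials normalized by $P_n^{(\alpha)}(1)=1$, i.e. $P_0^{(\alpha)}=1$, $P_1^{(\alpha)}(t)=t$ and $$t\,P_n^{(\alpha)}(t)=\frac{n}{2n+2\alpha+1}P_{n-1}^{(\alpha)}(t)+\frac{n+2\alpha+1}{2n+2\alpha+1}P_{n+1}^{(\alpha)}(t)\qquad(n\ge 1).$$ Write $P_m^{(\alpha)}P_n^{(\alpha)}=\sum_k c(m,n,k)P_k^{(\alpha)}$, put $\delta_m\star\delta_n=\sum_k c(m,n,k)\,\delta_k$ and extend $\star$ bilinearly to probability measures on $\mathbb N=\{0,1,2,\dots\}$. Let $\mu$ be a probability measure on $\mathbb N$ with $\sum_n n^2\mu(n)<\infty$, and let $p^{(n)}(x,y)$ be the $n$-step transition probabilities of the Markov chain on $\mathbb N$ with kernel $p(x,y)=(\delta_x\star\mu)(y)$. Assume that $\mu$ is aperiodic, i.e. the support of $\mu$ is contained neither in $2\mathbb N$ nor in $2\mathbb N+1$ and, if $\alpha=-\tfrac12$, it is not contained in $d\,\mathbb N$ for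 any integer $d\ge 2$. Let $$C=\frac{1}{4(\alpha+1)}\sum_{n\ge1}\mu(n)\,n(n+2\alpha+1).$$ Then, for every real $x>0$, as $n\to\infty$, $$\sqrt n\;p^{(n)}\big(\lfloor x\sqrt n\rfloor,\lfloor x\sqrt n\rfloor\big)\sim\frac{x}{2C}\,e^{-x^2/(2C)}\,I_\alpha\!\Big(\frac{x^2}{2C}\Big)$$ and $$\sqrt n\;p^{(n)}\big(0,\lfloor x\sqrt n\rfloor\big)\sim\frac{x^{2\alpha+1}e^{-x^2/(4C)}}{2^{2\alpha+1}C^{\alpha+1}\Gamma(\alpha+1)},$$ where $I_\alpha(z)=\sum_{k\ge0}\frac{(z/2)^{2k+\alpha}}{k!\,\Gamma(k+\alpha+1)}$ is the modified Bessel function of the first kind. -/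

import Mathlib

open Filter Asymptotics Polynomial

noncomputable section

namespace GegenbauerWalk

/-- The Gegenbauer (ultraspherical) polynomial `P_n^{(α)}`, normalized by `P_n^{(α)}(1) = 1`:
`P_0 = 1`, `P_1 = X` and, for `n ≥ 1`,
`X P_n = n / (2n + 2α + 1) P_{n-1} + (n + 2α + 1) / (2n + 2α + 1) P_{n+1}`.
The Rodrigues formula is proved below in `gegenbauer_rodrigues`. -/
def gegenbauer (α : ℝ) : ℕ → ℝ[X]
  | 0 => 1
  | 1 => X
  | n + 2 => C (((n : ℝ) + 2 * α + 2)⁻¹) *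
      (C (2 * (n : ℝ) + 2 * α + 3) * X * gegenbauer α (n + 1)
        - C ((n : ℝ) + 1) * gegenbauer α n)

theorem gegenbauer_eval_succ_succ (α x : ℝ) (n : ℕ) :
    (gegenbauer α (n + 2)).eval x = ((n : ℝ) + 2 * α + 2)⁻¹ *
      ((2 * (n : ℝ) + 2 * α + 3) * x * (gegenbauer α (n + 1)).eval x
        - ((n : ℝ) + 1) * (gegenbauer α n).eval x) := by
  simp [gegenbauer]

theorem gegenbauer_eval_deriv_succ_succ (α x : ℝ) (n : ℕ) :
    (derivative (gegenbauer α (n + 2))).eval x = ((n : ℝ) + 2 * α + 2)⁻¹ *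
      ((2 * (n : ℝ) + 2 * α + 3) * ((gegenbauer α (n + 1)).eval x
          + x * (derivative (gegenbauer α (n + 1))).eval x)
        - ((n : ℝ) + 1) * (derivative (gegenbauer α n)).eval x) := by
  simp only [gegenbauer, derivative_mul, derivative_sub, derivative_C, derivative_X, eval_add,
    eval_mul, eval_sub, eval_C, eval_X, zero_mul, zero_add, mul_one]
  ring

theorem gegenbauer_shift_aux (α : ℝ) (hα : -1 < α) (x : ℝ) (n : ℕ) :
    2 * (α + 1) * (x * (gegenbauer α (n + 1)).eval x - (gegenbauer α n).eval x)
      = -((n : ℝ) + 2 * α + 2) * (1 - x ^ 2) * (gegenbauer (α + 1) n).eval x := by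
  induction n using Nat.twoStepInduction with
  | zero => simp [gegenbauer]; ring
  | one =>
    have h : α + 1 ≠ 0 := by linarith
    have e : (2 * α + 2) * (gegenbauer α 2).eval x = (2 * α + 3) * x * x - 1 := by
      rw [gegenbauer_eval_succ_succ]
      simp [gegenbauer]
      field_simp
    have q : (gegenbauer (α + 1) 1).eval x = x := by simp [gegenbauer]
    have p : (gegenbauer α 1).eval x = x := by simp [gegenbauer]
    rw [q, p]
    push_cast
    linear_combination x * e
  | more n h0 h1 =>
    have hn : (0 : ℝ) ≤ n := n.cast_nonneg
    have a2 : ((n : ℝ) + 2 * α + 2) ≠ 0 := by linarith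
    have a3 : ((n : ℝ) + 2 * α + 3) ≠ 0 := by linarith
    have a3' : (((n + 1 : ℕ) : ℝ) + 2 * α + 2) ≠ 0 := by push_cast; linarith
    have a4' : ((n : ℝ) + 2 * (α + 1) + 2) ≠ 0 := by linarith
    have e2 := gegenbauer_eval_succ_succ α x n
    have e3 := gegenbauer_eval_succ_succ α x (n + 1)
    have q2 := gegenbauer_eval_succ_succ (α + 1) x n
    rw [eq_inv_mul_iff_mul_eq₀ (by assumption)] at e2 e3 q2
    push_cast at e3 h1 ⊢
    refine mul_left_cancel₀ (mul_ne_zero a2 a3) ?_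
    linear_combination (-(1 - x ^ 2) * (n + 2 * α + 2) * (n + 2 * α + 3)) * -q2
      + ((n + 2 * α + 2) * (2 * n + 2 * α + 5) * x) * h1 - ((n + 2 * α + 3) * (n + 1)) * h0
      + (2 * (α + 1) * (n + 2 * α + 2) * x) * e3 - (2 * (α + 1) * (n + 2 * α + 3)) * e2

theorem gegenbauer_shift_deriv_aux (α : ℝ) (hα : -1 < α) (x : ℝ) (n : ℕ) :
    2 * (α + 1) * (gegenbauer α (n + 1)).eval x
      = 2 * (α + 1) * x * (gegenbauer (α + 1) n).eval x
        - (1 - x ^ 2) * (derivative (gegenbauer (α + 1) n)).eval x := by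
  induction n using Nat.twoStepInduction with
  | zero => simp [gegenbauer]
  | one =>
    have h : α + 1 ≠ 0 := by linarith
    have e : (2 * α + 2) * (gegenbauer α 2).eval x = (2 * α + 3) * x * x - 1 := by
      rw [gegenbauer_eval_succ_succ]
      simp [gegenbauer]
      field_simp
    have q : (gegenbauer (α + 1) 1).eval x = x := by simp [gegenbauer]
    have d : (derivative (gegenbauer (α + 1) 1)).eval x = 1 := by simp [gegenbauer]
    rw [q, d]
    linear_combination e
  | more n h0 h1 =>
    have hn : (0 : ℝ) ≤ n := n.cast_nonneg
    have a3 : ((n : ℝ) + 2 * α + 3) ≠ 0 := by linarith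
    have a3' : (((n + 1 : ℕ) : ℝ) + 2 * α + 2) ≠ 0 := by push_cast; linarith
    have a4 : ((n : ℝ) + 2 * α + 4) ≠ 0 := by linarith
    have a4' : ((n : ℝ) + 2 * (α + 1) + 2) ≠ 0 := by linarith
    have e3 := gegenbauer_eval_succ_succ α x (n + 1)
    have q2 := gegenbauer_eval_succ_succ (α + 1) x n
    have d2 := gegenbauer_eval_deriv_succ_succ (α + 1) x n
    have s1 := gegenbauer_shift_aux α hα x (n + 1)
    rw [eq_inv_mul_iff_mul_eq₀ (by assumption)] at e3 q2 d2
    push_cast at e3 s1 ⊢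
    refine mul_left_cancel₀ (mul_ne_zero a3 a4) ?_
    linear_combination (-(n + 2 * α + 3) * 2 * (α + 1) * x) * q2
      + ((n + 2 * α + 3) * (1 - x ^ 2)) * d2
      + ((n + 2 * α + 3) * (2 * n + 2 * α + 5) * x) * h1 - ((n + 2 * α + 3) * (n + 1)) * h0
      + (2 * (α + 1) * (n + 2 * α + 4)) * e3 + (2 * n + 2 * α + 5) * s1

/-- Unnormalized Rodrigues formula. -/
theorem gegenbauer_iteratedDeriv (n : ℕ) : ∀ (α : ℝ), -1 < α → ∀ x ∈ Set.Ioo (-1 : ℝ) 1,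
    iteratedDeriv n (fun y : ℝ => (1 - y ^ 2) ^ ((n : ℝ) + α)) x
      = (-1) ^ n * 2 ^ n * (∏ i ∈ Finset.range n, (α + (i + 1))) * (1 - x ^ 2) ^ α
        * (gegenbauer α n).eval x := by
  induction n with
  | zero => intro α hα x hx; simp [gegenbauer]
  | succ n ih =>
    intro α hα x hx
    have hpos : 0 < 1 - x ^ 2 := by nlinarith [hx.1, hx.2]
    rw [iteratedDeriv_succ]
    have hev : iteratedDeriv n (fun y : ℝ => (1 - y ^ 2) ^ (((n + 1 : ℕ) : ℝ) + α)) =ᶠ[nhds x]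
        fun y => (-1) ^ n * 2 ^ n * (∏ i ∈ Finset.range n, (α + 1 + (i + 1))) *
          ((1 - y ^ 2) ^ (α + 1) * (gegenbauer (α + 1) n).eval y) := by
      filter_upwards [isOpen_Ioo.mem_nhds hx] with y hy
      have := ih (α + 1) (by linarith) y hy
      rw [show ((n + 1 : ℕ) : ℝ) + α = n + (α + 1) by push_cast; ring, this]
      ring
    rw [hev.deriv_eq]
    have h1 : HasDerivAt (fun y : ℝ => (1 - y ^ 2) ^ (α + 1))
        (-(2 * x) * (α + 1) * (1 - x ^ 2) ^ α) x := by
      have h := ((hasDerivAt_pow 2 x).const_sub 1).rpow_const (p := α + 1) (Or.inl hpos.ne')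
      simpa using h
    have h2 := ((h1.mul ((gegenbauer (α + 1) n).hasDerivAt x)).const_mul
      ((-1) ^ n * 2 ^ n * (∏ i ∈ Finset.range n, (α + 1 + ((i : ℝ) + 1))))).deriv
    have h3 : (1 - x ^ 2) ^ (α + 1) = (1 - x ^ 2) ^ α * (1 - x ^ 2) := by
      rw [Real.rpow_add hpos, Real.rpow_one]
    have h4 : ∏ i ∈ Finset.range (n + 1), (α + ((i : ℝ) + 1))
        = (∏ i ∈ Finset.range n, (α + 1 + ((i : ℝ) + 1))) * (α + 1) := by
      rw [Finset.prod_range_succ']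
      congr 1
      · refine Finset.prod_congr rfl fun i _ => ?_
        push_cast; ring
      · push_cast; ring
    refine h2.trans ?_
    rw [h3, h4]
    linear_combination (-1) ^ n * 2 ^ n * (∏ i ∈ Finset.range n, (α + 1 + ((i : ℝ) + 1)))
      * (1 - x ^ 2) ^ α * gegenbauer_shift_deriv_aux α hα x n

/-- Rodrigues formula: on `(-1, 1)`, for `α > -1`,
`P_n^{(α)}(x) = (-1)^n / (2^n (α+1)⋯(α+n)) (1-x²)^{-α} (d/dx)^n (1-x²)^{n+α}`. -/
theorem gegenbauer_rodrigues (α : ℝ) (hα : -1 < α) (n : ℕ) (x : ℝ)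
    (hx : x ∈ Set.Ioo (-1 : ℝ) 1) :
    (gegenbauer α n).eval x = (-1) ^ n / (2 ^ n * ∏ i ∈ Finset.range n, (α + (i + 1)))
      * (1 - x ^ 2) ^ (-α) * iteratedDeriv n (fun y : ℝ => (1 - y ^ 2) ^ ((n : ℝ) + α)) x := by
  have hpos : 0 < 1 - x ^ 2 := by nlinarith [hx.1, hx.2]
  have hprod : ∏ i ∈ Finset.range n, (α + ((i : ℝ) + 1)) ≠ 0 :=
    Finset.prod_ne_zero_iff.mpr fun i _ => by
      have : (0 : ℝ) ≤ i := i.cast_nonneg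
      linarith
  have h1 : ((-1 : ℝ) ^ n) * (-1) ^ n = 1 := by rw [← mul_pow]; simp
  have h2 : (1 - x ^ 2) ^ (-α) * (1 - x ^ 2) ^ α = 1 := by
    rw [← Real.rpow_add hpos]; simp
  rw [gegenbauer_iteratedDeriv n α hα x hx]
  field_simp
  linear_combination -(gegenbauer α n).eval x * h2
    - (gegenbauer α n).eval x * (1 - x ^ 2) ^ (-α) * (1 - x ^ 2) ^ α * h1

theorem gegenbauer_degree (α : ℝ) (hα : -1 < α) (n : ℕ) : (gegenbauer α n).degree = n := by
  induction n using Nat.twoStepInduction with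
  | zero => simp [gegenbauer]
  | one => simp [gegenbauer]
  | more n h0 h1 =>
    have hn : (0 : ℝ) ≤ n := n.cast_nonneg
    have a : ((n : ℝ) + 2 * α + 2)⁻¹ ≠ 0 := inv_ne_zero (by linarith)
    have b : (2 * (n : ℝ) + 2 * α + 3) ≠ 0 := by linarith
    have c : ((n : ℝ) + 1) ≠ 0 := by linarith
    have hA : (C (2 * (n : ℝ) + 2 * α + 3) * X * gegenbauer α (n + 1)).degree
        = ((n + 2 : ℕ) : WithBot ℕ) := by
      rw [degree_mul, degree_mul, degree_C b, degree_X, h1]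
      norm_cast
      omega
    have hB : (C ((n : ℝ) + 1) * gegenbauer α n).degree = (n : WithBot ℕ) := by
      rw [degree_mul, degree_C c, h0, zero_add]
    rw [gegenbauer, degree_mul, degree_C a, zero_add, degree_sub_eq_left_of_degree_lt, hA]
    rw [hA, hB]
    exact_mod_cast (by omega : n < n + 2)

/-- For `α ≥ -1/2` the Gegenbauer polynomials form a basis of `ℝ[X]`. -/
def gegenbauerBasis (α : ℝ) (hα : -1 / 2 ≤ α) : Module.Basis ℕ ℝ ℝ[X] :=
  Polynomial.Sequence.basis ⟨gegenbauer α, gegenbauer_degree α (by linarith)⟩ fun i =>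
    (leadingCoeff_ne_zero.mpr (Polynomial.Sequence.ne_zero _ i)).isUnit

theorem gegenbauerBasis_apply (α : ℝ) (hα : -1 / 2 ≤ α) (n : ℕ) :
    gegenbauerBasis α hα n = gegenbauer α n := by
  simp [gegenbauerBasis]

/-- Linearization coefficients: `linCoeff α hα m n k` is the coefficient of `P_k^{(α)}` in the
expansion of the product `P_m^{(α)} P_n^{(α)}` in Gegenbauer polynomials, that is, the mass of
`δ_m ⋆ δ_n` at `k`. -/
def linCoeff (α : ℝ) (hα : -1 / 2 ≤ α) (m n k : ℕ) : ℝ :=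
  (gegenbauerBasis α hα).repr (gegenbauer α m * gegenbauer α n) k

/-- The generalized convolution `μ ⋆ ν = ∑_{m,n} μ(m) ν(n) δ_m ⋆ δ_n` on `ℕ`; a measure on `ℕ` is
given by its masses at points. -/
def conv (α : ℝ) (hα : -1 / 2 ≤ α) (μ ν : ℕ → ℝ) (k : ℕ) : ℝ :=
  ∑' p : ℕ × ℕ, μ p.1 * ν p.2 * linCoeff α hα p.1 p.2 k

/-- One-step transition probability `p(x, y) = (δ_x ⋆ μ)(y)` of the random walk associated with
Gegenbauer polynomials. -/
def step (α : ℝ) (hα : -1 / 2 ≤ α) (μ : PMF ℕ) (x y : ℕ) : ℝ :=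
  conv α hα (Pi.single x 1) (fun n => (μ n).toReal) y

/-- `n`-step transition probability `p^{(n)}(x, y)` of the Markov chain with kernel `step`. -/
def nStep (α : ℝ) (hα : -1 / 2 ≤ α) (μ : PMF ℕ) : ℕ → ℕ → ℕ → ℝ
  | 0, x, y => if x = y then 1 else 0
  | n + 1, x, y => ∑' z, nStep α hα μ n x z * step α hα μ z y

/-- Aperiodicity of the step law: its support lies neither in the even nor in the odd numbers and,
in the case `α = -1/2` (where the walk is a reflected symmetric walk on `ℤ`), in no `dℕ` with
`d ≥ 2` either. -/
def IsAperiodic (α : ℝ) (μ : PMF ℕ) : Prop :=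
  ¬ (μ.support ⊆ {n | Even n}) ∧ ¬ (μ.support ⊆ {n | Odd n}) ∧
    (α = -1 / 2 → ∀ d : ℕ, 2 ≤ d → ¬ (μ.support ⊆ {n | d ∣ n}))

/-- `C = (4(α+1))⁻¹ ∑_{n ≥ 1} μ(n) n (n + 2α + 1)`; the term `n = 0` vanishes. -/
def diffConst (α : ℝ) (μ : PMF ℕ) : ℝ :=
  1 / (4 * (α + 1)) * ∑' n : ℕ, (μ n).toReal * ((n : ℝ) * ((n : ℝ) + 2 * α + 1))

/-- The modified Bessel function of the first kind
`I_α(z) = ∑_k (z/2)^{2k+α} / (k! Γ(k+α+1))`, for `z > 0`. -/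
def besselI (α z : ℝ) : ℝ :=
  ∑' k : ℕ, (z / 2) ^ (2 * (k : ℝ) + α) / ((k.factorial : ℝ) * Real.Gamma ((k : ℝ) + α + 1))

end GegenbauerWalk

end

/-! In the variable `t = cos θ` the Gegenbauer polynomials are orthogonal on `[0, π]` for the weight
`sin^{2α+1} θ`. Multiplication by the transform `φ(θ) = ∑ μ(k) P_k(cos θ)` diagonalises the kernel,
so that `p^{(n)}(x,y) = h_y⁻¹ ∫ φ^n P_x P_y sin^{2α+1} dθ` with `h_y` the squared norm of `P_y`
(`nStep_eq`, proved from Parseval's identity). Nonnegativity of the linearization coefficients plays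
no role: all bounds come from `|P_n| ≤ 1` on `[-1, 1]`, which Sonin's monotone function provides.

Substitute `θ = s/√n`. Then `φ(s/√n)^n → exp(-C s²)`, because `1 - φ(θ) ~ C θ²`; the Mehler–Heine
limit turns `P_N(cos(s/√n))` with `N ~ v√n` into a normalized Bessel function of `v s`; the rescaled
weight tends to `s^{2α+1}`; and `h_y⁻¹` grows like a constant times `y^{2α+1}`. Aperiodicity gives
`|φ| < 1` on `(0, π]`, which together with the behaviour at `0` yields `|φ(θ)| ≤ exp(-c θ²)`
(`exists_abs_transform_le_exp`), a Gaussian bound that permits dominated convergence.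

The limiting integral is Weber's second exponential integral, evaluated by power series and the
Chu–Vandermonde identity (`integral_weber`). The result is `tendsto_sqrt_mul_nStep`, for starting
points `~ u√n` and end points `~ v√n`; the two claims are `u = v = x` and `u = 0, v = x`. -/

namespace GegenbauerWalk

/-! ### Recurrences, derivatives and the differential equation. -/

theorem gegenbauer_eval_recurrence (α : ℝ) (hα : -1 < α) (x : ℝ) (n : ℕ) :
    ((n : ℝ) + 2 * α + 2) * (gegenbauer α (n + 2)).eval x
      = (2 * (n : ℝ) + 2 * α + 3) * x * (gegenbauer α (n + 1)).eval x
        - ((n : ℝ) + 1) * (gegenbauer α n).eval x := by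
  have hn : (0 : ℝ) ≤ n := n.cast_nonneg
  have a2 : ((n : ℝ) + 2 * α + 2) ≠ 0 := by linarith
  rw [gegenbauer_eval_succ_succ, mul_inv_cancel_left₀ a2]

theorem gegenbauer_eval_deriv_recurrence (α : ℝ) (hα : -1 < α) (x : ℝ) (n : ℕ) :
    ((n : ℝ) + 2 * α + 2) * (derivative (gegenbauer α (n + 2))).eval x
      = (2 * (n : ℝ) + 2 * α + 3) * ((gegenbauer α (n + 1)).eval x
          + x * (derivative (gegenbauer α (n + 1))).eval x)
        - ((n : ℝ) + 1) * (derivative (gegenbauer α n)).eval x := by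
  have hn : (0 : ℝ) ≤ n := n.cast_nonneg
  have a2 : ((n : ℝ) + 2 * α + 2) ≠ 0 := by linarith
  rw [gegenbauer_eval_deriv_succ_succ, mul_inv_cancel_left₀ a2]

theorem gegenbauer_eval_zero (α x : ℝ) : (gegenbauer α 0).eval x = 1 := by simp [gegenbauer]

theorem gegenbauer_eval_index_one (α x : ℝ) : (gegenbauer α 1).eval x = x := by simp [gegenbauer]

theorem gegenbauer_eval_one (α : ℝ) (hα : -1 < α) (n : ℕ) : (gegenbauer α n).eval 1 = 1 := by
  induction n using Nat.twoStepInduction with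
  | zero => simp [gegenbauer]
  | one => simp [gegenbauer]
  | more n h0 h1 =>
    have hn : (0 : ℝ) ≤ n := n.cast_nonneg
    have a2 : ((n : ℝ) + 2 * α + 2) ≠ 0 := by linarith
    have e := gegenbauer_eval_recurrence α hα 1 n
    rw [h0, h1] at e
    refine mul_left_cancel₀ a2 ?_
    linear_combination e

theorem gegenbauer_eval_neg (α x : ℝ) (n : ℕ) :
    (gegenbauer α n).eval (-x) = (-1) ^ n * (gegenbauer α n).eval x := by
  induction n using Nat.twoStepInduction with
  | zero => simp [gegenbauer]
  | one => simp [gegenbauer]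
  | more n h0 h1 =>
    rw [gegenbauer_eval_succ_succ, gegenbauer_eval_succ_succ, h0, h1]
    ring

/-- Contiguity relations between the parameters `α` and `α + 1`. -/
theorem gegenbauer_contiguous (α : ℝ) (hα : -1 < α) (x : ℝ) (n : ℕ) :
    2 * (α + 1) * (gegenbauer α (n + 1)).eval x
        = ((n : ℝ) + 2 * α + 3) * (gegenbauer (α + 1) (n + 1)).eval x
          - ((n : ℝ) + 1) * x * (gegenbauer (α + 1) n).eval x ∧
      2 * (α + 1) * (gegenbauer α (n + 2)).eval x
        = ((n : ℝ) + 2 * α + 3) * x * (gegenbauer (α + 1) (n + 1)).eval x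
          - ((n : ℝ) + 1) * (gegenbauer (α + 1) n).eval x := by
  induction n with
  | zero =>
    have e := gegenbauer_eval_recurrence α hα x 0
    simp only [gegenbauer_eval_zero, gegenbauer_eval_index_one, zero_add] at e ⊢
    push_cast at e ⊢
    constructor
    · ring
    · linear_combination e
  | succ n ih =>
    obtain ⟨h0, h1⟩ := ih
    have hn : (0 : ℝ) ≤ n := n.cast_nonneg
    have a3 : ((n : ℝ) + 2 * α + 3) ≠ 0 := by linarith
    have e3 := gegenbauer_eval_recurrence α hα x (n + 1)
    have q2 := gegenbauer_eval_recurrence (α + 1) (by linarith) x n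
    push_cast at e3 ⊢
    constructor
    · linear_combination h1 - q2
    · refine mul_left_cancel₀ a3 ?_
      linear_combination 2 * (α + 1) * e3 + (2 * n + 2 * α + 5) * x * h1 - (n + 2) * h0
        - (n + 2 * α + 3) * x * q2

/-- Differentiating the recurrence leaves one undifferentiated polynomial of parameter `α`;
contiguity moves it to parameter `α + 1`, where the recurrence for `α + 1` closes the induction. -/
theorem gegenbauer_eval_derivative (α : ℝ) (hα : -1 < α) (x : ℝ) (n : ℕ) :
    2 * (α + 1) * (derivative (gegenbauer α (n + 1))).eval x
      = ((n : ℝ) + 1) * ((n : ℝ) + 2 * α + 2) * (gegenbauer (α + 1) n).eval x := by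
  induction n using Nat.twoStepInduction with
  | zero => simp [gegenbauer]; ring
  | one =>
    have e := gegenbauer_eval_deriv_recurrence α hα x 0
    have d0 : (derivative (gegenbauer α 0)).eval x = 0 := by simp [gegenbauer]
    have d1 : (derivative (gegenbauer α 1)).eval x = 1 := by simp [gegenbauer]
    simp only [zero_add] at e
    rw [d0, d1, gegenbauer_eval_index_one] at e
    rw [gegenbauer_eval_index_one]
    push_cast at e ⊢
    linear_combination e
  | more n h0 h1 =>
    have hn : (0 : ℝ) ≤ n := n.cast_nonneg
    have a3 : ((n : ℝ) + 2 * α + 3) ≠ 0 := by linarith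
    have e := gegenbauer_eval_deriv_recurrence α hα x (n + 1)
    have q2 := gegenbauer_eval_recurrence (α + 1) (by linarith) x n
    have s := (gegenbauer_contiguous α hα x n).2
    push_cast at e h1 ⊢
    refine mul_left_cancel₀ a3 ?_
    linear_combination 2 * (α + 1) * e + (2 * n + 2 * α + 5) * s
      + (2 * n + 2 * α + 5) * x * h1 - (n + 2) * h0 - (n + 3) * (n + 2 * α + 3) * q2

theorem derivative_gegenbauer (α : ℝ) (hα : -1 < α) (n : ℕ) :
    derivative (gegenbauer α (n + 1))
      = C (((n : ℝ) + 1) * ((n : ℝ) + 2 * α + 2) / (2 * (α + 1))) * gegenbauer (α + 1) n := by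
  refine Polynomial.funext fun x => ?_
  have h : 2 * (α + 1) ≠ 0 := by linarith
  rw [eval_mul, eval_C, div_mul_eq_mul_div, eq_div_iff h, mul_comm]
  exact gegenbauer_eval_derivative α hα x n

/-- The ultraspherical differential equation. -/
theorem gegenbauer_ode (α : ℝ) (hα : -1 < α) (x : ℝ) (n : ℕ) :
    (n : ℝ) * ((n : ℝ) + 2 * α + 1) * (gegenbauer α n).eval x
      = 2 * (α + 1) * x * (derivative (gegenbauer α n)).eval x
        - (1 - x ^ 2) * (derivative (derivative (gegenbauer α n))).eval x := by
  cases n with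
  | zero => simp [gegenbauer]
  | succ n =>
    have h : 2 * (α + 1) ≠ 0 := by linarith
    -- `P'` is a multiple of a polynomial of parameter `α + 1`, so this first-order relation,
    -- rescaled, is the second-order equation.
    have s := gegenbauer_shift_deriv_aux α hα x n
    rw [derivative_gegenbauer α hα, derivative_C_mul, eval_mul, eval_mul, eval_C]
    refine mul_left_cancel₀ h ?_
    push_cast
    have e : 2 * (α + 1) * (((n : ℝ) + 1) * ((n : ℝ) + 2 * α + 2) / (2 * (α + 1)))
      = ((n : ℝ) + 1) * ((n : ℝ) + 2 * α + 2) := mul_div_cancel₀ _ h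
    linear_combination ((n : ℝ) + 1) * ((n : ℝ) + 2 * α + 2) * s
      - (2 * (α + 1) * x * (gegenbauer (α + 1) n).eval x
        - (1 - x ^ 2) * (derivative (gegenbauer (α + 1) n)).eval x) * e

/-! ### Bounds on `[-1, 1]` from Sonin's function. -/

/-- Sonin's function is monotone on `[0, 1]`. -/
theorem monotoneOn_sonin (α : ℝ) (hα : -1 / 2 ≤ α) (n : ℕ) :
    MonotoneOn (fun x : ℝ => (n : ℝ) * ((n : ℝ) + 2 * α + 1) * (gegenbauer α n).eval x ^ 2
      + (1 - x ^ 2) * (derivative (gegenbauer α n)).eval x ^ 2) (Set.Icc 0 1) := by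
  have hd : ∀ x : ℝ, HasDerivAt (fun x : ℝ => (n : ℝ) * ((n : ℝ) + 2 * α + 1) *
      (gegenbauer α n).eval x ^ 2 + (1 - x ^ 2) * (derivative (gegenbauer α n)).eval x ^ 2)
      (2 * (2 * α + 1) * x * (derivative (gegenbauer α n)).eval x ^ 2) x := by
    intro x
    have h1 := (((gegenbauer α n).hasDerivAt x).pow 2).const_mul
      ((n : ℝ) * ((n : ℝ) + 2 * α + 1))
    have h2 := ((hasDerivAt_pow 2 x).const_sub 1).mul
      (((derivative (gegenbauer α n)).hasDerivAt x).pow 2)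
    refine HasDerivAt.congr_deriv (h1.add h2) ?_
    -- Eliminating `P''` cancels the products `P P'` and leaves only `2(2α+1) x P'²`, whose sign is
    -- where `α ≥ -1/2` enters.
    have e := gegenbauer_ode α (by linarith) x n
    push_cast
    rw [Pi.pow_apply]
    linear_combination 2 * (derivative (gegenbauer α n)).eval x * e
  refine monotoneOn_of_deriv_nonneg (convex_Icc 0 1)
    (fun x _ => (hd x).continuousAt.continuousWithinAt)
    (fun x _ => (hd x).differentiableAt.differentiableWithinAt) fun x hx => ?_
  rw [interior_Icc] at hx
  rw [(hd x).deriv]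
  have : 0 ≤ 2 * α + 1 := by linarith
  have := hx.1
  positivity

theorem abs_gegenbauer_eval_abs (α x : ℝ) (n : ℕ) :
    |(gegenbauer α n).eval (|x|)| = |(gegenbauer α n).eval x| := by
  rcases abs_choice x with h | h <;> rw [h]
  rw [gegenbauer_eval_neg, abs_mul]
  simp

/-- Sonin's function dominates `n(n+2α+1) P_n²` on `[0, 1]` and equals `n(n+2α+1)` at `1`; parity
handles negative `x`. -/
theorem abs_gegenbauer_eval_le_one (α : ℝ) (hα : -1 / 2 ≤ α) (n : ℕ) {x : ℝ}
    (hx : |x| ≤ 1) : |(gegenbauer α n).eval x| ≤ 1 := by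
  rcases Nat.eq_zero_or_pos n with rfl | hn
  · simp [gegenbauer]
  rw [← abs_gegenbauer_eval_abs]
  have h := monotoneOn_sonin α hα n ⟨abs_nonneg x, hx⟩ (Set.right_mem_Icc.2 zero_le_one) hx
  simp only [gegenbauer_eval_one α (by linarith)] at h
  have hn' : (0 : ℝ) < n := by exact_mod_cast hn
  have hl : (0 : ℝ) < (n : ℝ) * ((n : ℝ) + 2 * α + 1) := mul_pos hn' (by linarith)
  have h2 : 0 ≤ (1 - |x| ^ 2) * (derivative (gegenbauer α n)).eval (|x|) ^ 2 :=
    mul_nonneg (by nlinarith [abs_nonneg x]) (sq_nonneg _)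
  rw [← sq_le_one_iff_abs_le_one]
  refine le_of_mul_le_mul_left ?_ hl
  linarith

/-- Equality would make Sonin's function constant on `(|x|, 1)`, hence constant as a polynomial; its
derivative `2(2α+1) x P'²` then forces `P' = 0`. At `α = -1/2` this breaks down, since there
`P_n(cos θ) = cos nθ`. -/
theorem abs_gegenbauer_eval_lt_one (α : ℝ) (hα : -1 / 2 < α) (n : ℕ) (hn : n ≠ 0) {x : ℝ}
    (hx : |x| < 1) : |(gegenbauer α n).eval x| < 1 := by
  have hn' : (0 : ℝ) < n := by exact_mod_cast Nat.pos_of_ne_zero hn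
  have hl : (0 : ℝ) < (n : ℝ) * ((n : ℝ) + 2 * α + 1) := mul_pos hn' (by linarith)
  refine lt_of_le_of_ne (abs_gegenbauer_eval_le_one α hα.le n hx.le) fun h1 => ?_
  rw [← abs_gegenbauer_eval_abs] at h1
  have hmono := monotoneOn_sonin α hα.le n
  set F : ℝ → ℝ := fun x : ℝ => (n : ℝ) * ((n : ℝ) + 2 * α + 1) * (gegenbauer α n).eval x ^ 2
      + (1 - x ^ 2) * (derivative (gegenbauer α n)).eval x ^ 2 with hF
  have hF1 : F 1 = (n : ℝ) * ((n : ℝ) + 2 * α + 1) := by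
    simp [hF, gegenbauer_eval_one α (by linarith : -1 < α)]
  have hFx : (n : ℝ) * ((n : ℝ) + 2 * α + 1) ≤ F |x| := by
    have h2 : 0 ≤ (1 - |x| ^ 2) * (derivative (gegenbauer α n)).eval (|x|) ^ 2 :=
      mul_nonneg (by nlinarith [abs_nonneg x]) (sq_nonneg _)
    have h3 : (gegenbauer α n).eval (|x|) ^ 2 = 1 := by rw [← sq_abs, h1, one_pow]
    simp only [hF, h3]
    linarith
  have hconst : ∀ y ∈ Set.Ioo (|x|) 1, F y = F 1 := fun y hy => by
    have hy0 : y ∈ Set.Icc (0 : ℝ) 1 := ⟨(abs_nonneg x).trans hy.1.le, hy.2.le⟩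
    refine le_antisymm (hmono hy0 (Set.right_mem_Icc.2 zero_le_one) hy.2.le) ?_
    rw [hF1]
    exact hFx.trans (hmono ⟨abs_nonneg x, hx.le⟩ hy0 hy.1.le)
  have hpoly : C ((n : ℝ) * ((n : ℝ) + 2 * α + 1)) * gegenbauer α n ^ 2
      + (1 - X ^ 2) * derivative (gegenbauer α n) ^ 2 = C (F 1) := by
    refine Polynomial.eq_of_infinite_eval_eq _ _ ((Set.Ioo_infinite hx).mono fun y hy => ?_)
    simpa [hF] using hconst y hy
  have hder : (derivative (gegenbauer α n)) ^ 2 = 0 := by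
    refine Polynomial.eq_of_infinite_eval_eq _ _
      ((Set.Ioo_infinite (zero_lt_one (α := ℝ))).mono fun y hy => ?_)
    have e := congrArg (fun p => (derivative p).eval y) hpoly
    simp [derivative_pow] at e
    have o := gegenbauer_ode α (by linarith) y n
    have h5 : (2 * (2 * α + 1) * y) * (derivative (gegenbauer α n)).eval y ^ 2 = 0 := by
      linear_combination e - 2 * (derivative (gegenbauer α n)).eval y * o
    have hy0 : (2 * (2 * α + 1) * y) ≠ 0 := by
      have : 0 < 2 * α + 1 := by linarith
      have := hy.1
      positivity
    simpa [hy0] using h5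
  have hdeg := derivative_eq_zero.1 (pow_eq_zero_iff two_ne_zero |>.1 hder)
  rw [natDegree_eq_of_degree_eq_some (gegenbauer_degree α (by linarith) n)] at hdeg
  exact hn hdeg

theorem abs_derivative_gegenbauer_eval_le (α : ℝ) (hα : -1 / 2 ≤ α) (n : ℕ) {x : ℝ}
    (hx : |x| ≤ 1) : |(derivative (gegenbauer α n)).eval x|
      ≤ (n : ℝ) * ((n : ℝ) + 2 * α + 1) / (2 * (α + 1)) := by
  cases n with
  | zero => simp [gegenbauer]
  | succ n =>
    have hc : 0 ≤ ((n : ℝ) + 1) * ((n : ℝ) + 2 * α + 2) / (2 * (α + 1)) := by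
      have hn : (0 : ℝ) ≤ n := n.cast_nonneg
      exact div_nonneg (mul_nonneg (by linarith) (by linarith)) (by linarith)
    rw [derivative_gegenbauer α (by linarith), eval_mul, eval_C, abs_mul, abs_of_nonneg hc]
    have := abs_gegenbauer_eval_le_one (α + 1) (by linarith) n hx
    push_cast
    rw [show (n : ℝ) + 1 + 2 * α + 1 = n + 2 * α + 2 by ring]
    exact mul_le_of_le_one_right hc this

/-! ### Derivatives at `1` and the Taylor expansion there. -/

theorem derivative_gegenbauer_eval_one (α : ℝ) (hα : -1 < α) (n : ℕ) :
    (derivative (gegenbauer α n)).eval 1 = (n : ℝ) * ((n : ℝ) + 2 * α + 1) / (2 * (α + 1)) := by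
  cases n with
  | zero => simp [gegenbauer]
  | succ n =>
    rw [derivative_gegenbauer α hα, eval_mul, eval_C, gegenbauer_eval_one _ (by linarith)]
    push_cast
    ring

theorem iterate_derivative_gegenbauer_eval_one (k : ℕ) : ∀ (α : ℝ), -1 < α → ∀ n : ℕ,
    (derivative^[k] (gegenbauer α n)).eval 1
      = ∏ i ∈ Finset.range k,
        ((n : ℝ) - i) * ((n : ℝ) + 2 * α + 1 + i) / (2 * (α + 1 + i)) := by
  induction k with
  | zero => intro α hα n; simp [gegenbauer_eval_one α hα n]
  | succ k ih =>
    intro α hα n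
    rw [Function.iterate_succ_apply]
    cases n with
    | zero => simp [gegenbauer, Finset.prod_range_succ']
    | succ n =>
      rw [derivative_gegenbauer α hα, ← smul_eq_C_mul, iterate_derivative_smul, eval_smul,
        ih (α + 1) (by linarith) n, Finset.prod_range_succ', smul_eq_mul, mul_comm]
      congr 1
      · refine Finset.prod_congr rfl fun i _ => ?_
        push_cast
        congr 1 <;> ring
      · push_cast
        congr 1 <;> ring

/-- The expansion of the Gegenbauer polynomials at `1`. -/
theorem gegenbauer_eval_eq_sum (α : ℝ) (hα : -1 < α) (n : ℕ) (x : ℝ) :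
    (gegenbauer α n).eval x = ∑ k ∈ Finset.range (n + 1),
      (∏ i ∈ Finset.range k, ((n : ℝ) - i) * ((n : ℝ) + 2 * α + 1 + i) / (2 * (α + 1 + i)))
        / (k.factorial : ℝ) * (x - 1) ^ k := by
  have h := Polynomial.taylor_eval 1 (gegenbauer α n) (x - 1)
  rw [sub_add_cancel] at h
  have hdeg : (taylor 1 (gegenbauer α n)).natDegree = n := by
    rw [natDegree_taylor, natDegree_eq_of_degree_eq_some (gegenbauer_degree α hα n)]
  rw [← h, eval_eq_sum_range, hdeg]
  refine Finset.sum_congr rfl fun k _ => ?_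
  rw [taylor_coeff, ← iterate_derivative_gegenbauer_eval_one k α hα n,
    ← factorial_smul_hasseDeriv]
  have : (k.factorial : ℝ) ≠ 0 := by exact_mod_cast k.factorial_ne_zero
  simp [this]

/-! ### Orthogonality and recurrence for the norms. -/

/-- Integration over `[0, π]` against the weight `sin^{2α+1}`. -/
noncomputable def weightedIntegral (α : ℝ) (f : ℝ → ℝ) : ℝ :=
  ∫ θ in (0 : ℝ)..Real.pi, f θ * Real.sin θ ^ (2 * α + 1)

/-- The Gegenbauer polynomial in the angular variable, `θ ↦ P_n^{(α)}(cos θ)`. -/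
noncomputable def gegenbauerCos (α : ℝ) (n : ℕ) (θ : ℝ) : ℝ :=
  (gegenbauer α n).eval (Real.cos θ)

theorem continuous_gegenbauerCos (α : ℝ) (n : ℕ) : Continuous (gegenbauerCos α n) :=
  (gegenbauer α n).continuous.comp Real.continuous_cos

theorem abs_gegenbauerCos_le_one (α : ℝ) (hα : -1 / 2 ≤ α) (n : ℕ) (θ : ℝ) :
    |gegenbauerCos α n θ| ≤ 1 :=
  abs_gegenbauer_eval_le_one α hα n (Real.abs_cos_le_one θ)

theorem continuous_weight (α : ℝ) (hα : -1 / 2 ≤ α) :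
    Continuous fun θ : ℝ => Real.sin θ ^ (2 * α + 1) :=
  Real.continuous_sin.rpow_const fun _ => Or.inr (by linarith)

theorem intervalIntegrable_mul_weight (α : ℝ) (hα : -1 / 2 ≤ α) {f : ℝ → ℝ} (hf : Continuous f) :
    IntervalIntegrable (fun θ => f θ * Real.sin θ ^ (2 * α + 1)) MeasureTheory.volume 0 Real.pi :=
  (hf.mul (continuous_weight α hα)).intervalIntegrable _ _

theorem weightedIntegral_add (α : ℝ) (hα : -1 / 2 ≤ α) {f g : ℝ → ℝ} (hf : Continuous f)
    (hg : Continuous g) :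
    weightedIntegral α (fun θ => f θ + g θ) = weightedIntegral α f + weightedIntegral α g := by
  simp only [weightedIntegral, add_mul]
  exact intervalIntegral.integral_add (intervalIntegrable_mul_weight α hα hf)
    (intervalIntegrable_mul_weight α hα hg)

theorem weightedIntegral_sub (α : ℝ) (hα : -1 / 2 ≤ α) {f g : ℝ → ℝ} (hf : Continuous f)
    (hg : Continuous g) :
    weightedIntegral α (fun θ => f θ - g θ) = weightedIntegral α f - weightedIntegral α g := by
  simp only [weightedIntegral, sub_mul]
  exact intervalIntegral.integral_sub (intervalIntegrable_mul_weight α hα hf)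
    (intervalIntegrable_mul_weight α hα hg)

theorem weightedIntegral_const_mul (α c : ℝ) (f : ℝ → ℝ) :
    weightedIntegral α (fun θ => c * f θ) = c * weightedIntegral α f := by
  simp only [weightedIntegral, mul_assoc]
  exact intervalIntegral.integral_const_mul _ _

theorem weightedIntegral_finset_sum (α : ℝ) (hα : -1 / 2 ≤ α) {ι : Type*} (s : Finset ι)
    {f : ι → ℝ → ℝ} (hf : ∀ i, Continuous (f i)) :
    weightedIntegral α (fun θ => ∑ i ∈ s, f i θ) = ∑ i ∈ s, weightedIntegral α (f i) := by
  simp only [weightedIntegral, Finset.sum_mul]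
  exact intervalIntegral.integral_finsetSum fun i _ => intervalIntegrable_mul_weight α hα (hf i)

theorem weightedIntegral_mono (α : ℝ) (hα : -1 / 2 ≤ α) {f g : ℝ → ℝ} (hf : Continuous f)
    (hg : Continuous g) (h : ∀ θ ∈ Set.Icc 0 Real.pi, f θ ≤ g θ) :
    weightedIntegral α f ≤ weightedIntegral α g := by
  refine intervalIntegral.integral_mono_on Real.pi_pos.le (intervalIntegrable_mul_weight α hα hf)
    (intervalIntegrable_mul_weight α hα hg) fun θ hθ => ?_
  exact mul_le_mul_of_nonneg_right (h θ hθ)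
    (Real.rpow_nonneg (Real.sin_nonneg_of_nonneg_of_le_pi hθ.1 hθ.2) _)

theorem weightedIntegral_one_pos (α : ℝ) (hα : -1 / 2 ≤ α) : 0 < weightedIntegral α fun _ => 1 := by
  refine intervalIntegral.intervalIntegral_pos_of_pos_on
    (intervalIntegrable_mul_weight α hα continuous_const) (fun θ hθ => ?_) Real.pi_pos
  have := Real.sin_pos_of_pos_of_lt_pi hθ.1 hθ.2
  positivity

/-- Times the weight, the integrand is the derivative of `sin^{2α+2} θ · Q(cos θ)`, which vanishes
at both endpoints because `2α + 2 > 0`. -/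
theorem weightedIntegral_derivative (α : ℝ) (hα : -1 / 2 ≤ α) (Q : ℝ[X]) :
    weightedIntegral α (fun θ => 2 * (α + 1) * Real.cos θ * Q.eval (Real.cos θ)
      - (1 - Real.cos θ ^ 2) * (derivative Q).eval (Real.cos θ)) = 0 := by
  have hd : ∀ θ ∈ Set.uIcc 0 Real.pi, HasDerivAt
      (fun θ => Real.sin θ ^ (2 * α + 2) * Q.eval (Real.cos θ))
      ((2 * (α + 1) * Real.cos θ * Q.eval (Real.cos θ)
        - (1 - Real.cos θ ^ 2) * (derivative Q).eval (Real.cos θ))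
        * Real.sin θ ^ (2 * α + 1)) θ := by
    intro θ hθ
    rw [Set.uIcc_of_le Real.pi_pos.le] at hθ
    have h1 := (Real.hasDerivAt_sin θ).rpow_const (p := 2 * α + 2) (Or.inr (by linarith))
    have h2 := (Q.hasDerivAt (Real.cos θ)).comp θ (Real.hasDerivAt_cos θ)
    refine HasDerivAt.congr_deriv (h1.mul h2) ?_
    have h3 : Real.sin θ ^ (2 * α + 2) = Real.sin θ ^ (2 * α + 1) * Real.sin θ := by
      rw [← Real.rpow_add_one' (Real.sin_nonneg_of_nonneg_of_le_pi hθ.1 hθ.2) (by linarith)]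
      congr 1; ring
    have h4 : (2 * α + 2 - 1) = 2 * α + 1 := by ring
    simp only [h3, h4]
    linear_combination Real.sin θ ^ (2 * α + 1) * (derivative Q).eval (Real.cos θ) *
      -Real.sin_sq_add_cos_sq θ
  have hc : Continuous fun θ => 2 * (α + 1) * Real.cos θ * Q.eval (Real.cos θ)
        - (1 - Real.cos θ ^ 2) * (derivative Q).eval (Real.cos θ) := by
    have := Q.continuous
    have := (derivative Q).continuous
    fun_prop
  have h0 : (0 : ℝ) ^ (2 * α + 2) = 0 := Real.zero_rpow (by linarith)
  rw [weightedIntegral, intervalIntegral.integral_eq_sub_of_hasDerivAt hd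
    (intervalIntegrable_mul_weight α hα hc)]
  simp [h0]

/-- By `gegenbauer_shift_deriv_aux`, `2(α+1) P_{n+1}` is exactly the expression integrated in
`weightedIntegral_derivative`, with `Q` the polynomial of parameter `α + 1` and degree `n`. -/
theorem weightedIntegral_gegenbauerCos_succ (α : ℝ) (hα : -1 / 2 ≤ α) (n : ℕ) :
    weightedIntegral α (gegenbauerCos α (n + 1)) = 0 := by
  have h := weightedIntegral_derivative α hα (gegenbauer (α + 1) n)
  simp only [← gegenbauer_shift_deriv_aux α (by linarith : -1 < α)] at h
  rw [weightedIntegral_const_mul] at h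
  exact (mul_eq_zero.1 h).resolve_left (by linarith)

theorem gegenbauerCos_recurrence (α : ℝ) (hα : -1 < α) (n : ℕ) (θ : ℝ) :
    (2 * (n : ℝ) + 2 * α + 3) * (Real.cos θ * gegenbauerCos α (n + 1) θ)
      = ((n : ℝ) + 1) * gegenbauerCos α n θ + ((n : ℝ) + 2 * α + 2) * gegenbauerCos α (n + 2) θ := by
  have := gegenbauer_eval_recurrence α hα (Real.cos θ) n
  simp only [gegenbauerCos]
  linear_combination -this

/-- The recurrence relation integrated against a continuous function. -/
theorem weightedIntegral_recurrence (α : ℝ) (hα : -1 / 2 ≤ α) (n : ℕ) {f : ℝ → ℝ}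
    (hf : Continuous f) :
    (2 * (n : ℝ) + 2 * α + 3)
        * weightedIntegral α (fun θ => Real.cos θ * gegenbauerCos α (n + 1) θ * f θ)
      = ((n : ℝ) + 1) * weightedIntegral α (fun θ => gegenbauerCos α n θ * f θ)
        + ((n : ℝ) + 2 * α + 2)
          * weightedIntegral α (fun θ => gegenbauerCos α (n + 2) θ * f θ) := by
  have c0 := continuous_gegenbauerCos α n
  have c2 := continuous_gegenbauerCos α (n + 2)
  rw [← weightedIntegral_const_mul, ← weightedIntegral_const_mul, ← weightedIntegral_const_mul,
    ← weightedIntegral_add α hα (by fun_prop) (by fun_prop)]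
  congr 1
  funext θ
  linear_combination f θ * gegenbauerCos_recurrence α (by linarith) n θ

theorem gegenbauerCos_zero (α θ : ℝ) : gegenbauerCos α 0 θ = 1 := gegenbauer_eval_zero _ _

theorem gegenbauerCos_one (α θ : ℝ) : gegenbauerCos α 1 θ = Real.cos θ :=
  gegenbauer_eval_index_one _ _

/-- Expand `∫ cos θ · P_{m+1} P_n` by the recurrence in either factor. Expanding `cos θ · P_n` gives
pairings with `P_{m+1}` that vanish by induction; expanding `cos θ · P_{m+1}` then relates
`⟨P_{m+2}, P_n⟩` to `⟨P_m, P_n⟩ = 0`. -/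
theorem weightedIntegral_gegenbauerCos_mul_of_lt (α : ℝ) (hα : -1 / 2 ≤ α) (m : ℕ) :
    ∀ n, m < n → weightedIntegral α (fun θ => gegenbauerCos α m θ * gegenbauerCos α n θ) = 0 := by
  induction m using Nat.strong_induction_on with
  | _ m ih =>
    match m with
    | 0 =>
      intro n hn
      obtain ⟨k, rfl⟩ := Nat.exists_eq_succ_of_ne_zero hn.ne'
      simp only [gegenbauerCos_zero, one_mul]
      exact weightedIntegral_gegenbauerCos_succ α hα k
    | 1 =>
      intro n hn
      obtain ⟨k, rfl⟩ : ∃ k, n = k + 2 := ⟨n - 2, by omega⟩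
      have hk : (0 : ℝ) ≤ k := k.cast_nonneg
      have r := weightedIntegral_recurrence α hα (k + 1) (continuous_gegenbauerCos α 0)
      have e1 := ih 0 (by omega) (k + 1) (by omega)
      have e2 := ih 0 (by omega) (k + 1 + 2) (by omega)
      simp only [gegenbauerCos_zero, one_mul, mul_one] at r e1 e2
      rw [e1, e2] at r
      simp only [gegenbauerCos_one]
      refine (mul_eq_zero.1 (r.trans (by ring))).resolve_left ?_
      push_cast
      linarith
    | m + 2 =>
      intro n hn
      obtain ⟨k, rfl⟩ : ∃ k, n = k + 2 := ⟨n - 2, by omega⟩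
      have hk : (0 : ℝ) ≤ k := k.cast_nonneg
      have hm : (0 : ℝ) ≤ m := m.cast_nonneg
      have r1 := weightedIntegral_recurrence α hα m (continuous_gegenbauerCos α (k + 2))
      have r2 := weightedIntegral_recurrence α hα (k + 1) (continuous_gegenbauerCos α (m + 1))
      have e1 := ih m (by omega) (k + 2) (by omega)
      have e2 := ih (m + 1) (by omega) (k + 1) (by omega)
      have e3 := ih (m + 1) (by omega) (k + 1 + 2) (by omega)
      have c : ∀ i, weightedIntegral α (fun θ => gegenbauerCos α i θ * gegenbauerCos α (m + 1) θ)
          = weightedIntegral α (fun θ => gegenbauerCos α (m + 1) θ * gegenbauerCos α i θ) :=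
        fun i => by simp only [mul_comm]
      rw [c, c, e2, e3] at r2
      have c2 : weightedIntegral α
          (fun θ => Real.cos θ * gegenbauerCos α (k + 1 + 1) θ * gegenbauerCos α (m + 1) θ)
          = weightedIntegral α
          (fun θ => Real.cos θ * gegenbauerCos α (m + 1) θ * gegenbauerCos α (k + 2) θ) := by
        congr 1; funext θ; ring
      have c3 := (mul_eq_zero.1 (r2.trans (by ring))).resolve_left (by push_cast; linarith)
      rw [← c2, c3, e1, mul_zero, mul_zero, zero_add] at r1
      exact (mul_eq_zero.1 r1.symm).resolve_left (by linarith)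

theorem weightedIntegral_gegenbauerCos_mul (α : ℝ) (hα : -1 / 2 ≤ α) {m n : ℕ} (h : m ≠ n) :
    weightedIntegral α (fun θ => gegenbauerCos α m θ * gegenbauerCos α n θ) = 0 := by
  rcases lt_or_gt_of_ne h with h | h
  · exact weightedIntegral_gegenbauerCos_mul_of_lt α hα m n h
  · simp only [mul_comm (gegenbauerCos α m _)]
    exact weightedIntegral_gegenbauerCos_mul_of_lt α hα n m h

/-- The squared norm of the Gegenbauer polynomial `P_n^{(α)}` with respect to the weight. -/
noncomputable def sqNorm (α : ℝ) (n : ℕ) : ℝ :=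
  weightedIntegral α fun θ => gegenbauerCos α n θ * gegenbauerCos α n θ

theorem sqNorm_zero (α : ℝ) : sqNorm α 0 = weightedIntegral α fun _ => 1 := by
  simp [sqNorm, gegenbauerCos_zero]

theorem sqNorm_one (α : ℝ) (hα : -1 / 2 ≤ α) : (2 * α + 3) * sqNorm α 1 = sqNorm α 0 := by
  have r := weightedIntegral_recurrence α hα 0 (continuous_gegenbauerCos α 0)
  have e := weightedIntegral_gegenbauerCos_mul α hα (m := 0 + 2) (n := 0) (by omega)
  rw [e] at r
  simp only [gegenbauerCos_zero, gegenbauerCos_one, zero_add, mul_one] at r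
  simp only [sqNorm, gegenbauerCos_zero, gegenbauerCos_one, mul_one]
  push_cast at r
  linear_combination r

/-- Both expansions of `∫ cos θ · P_{n+1} P_{n+2}`; orthogonality leaves one norm on each side. -/
theorem sqNorm_succ_succ (α : ℝ) (hα : -1 / 2 ≤ α) (n : ℕ) :
    ((n : ℝ) + 2 * α + 2) * (2 * (n : ℝ) + 2 * α + 5) * sqNorm α (n + 2)
      = (2 * (n : ℝ) + 2 * α + 3) * ((n : ℝ) + 2) * sqNorm α (n + 1) := by
  have r1 := weightedIntegral_recurrence α hα n (continuous_gegenbauerCos α (n + 2))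
  have r2 := weightedIntegral_recurrence α hα (n + 1) (continuous_gegenbauerCos α (n + 1))
  rw [weightedIntegral_gegenbauerCos_mul α hα (by omega)] at r1
  rw [weightedIntegral_gegenbauerCos_mul α hα (by omega : n + 1 + 2 ≠ n + 1)] at r2
  have c2 : weightedIntegral α
      (fun θ => Real.cos θ * gegenbauerCos α (n + 1 + 1) θ * gegenbauerCos α (n + 1) θ)
      = weightedIntegral α
      (fun θ => Real.cos θ * gegenbauerCos α (n + 1) θ * gegenbauerCos α (n + 2) θ) := by
    congr 1; funext θ; ring
  rw [c2] at r2
  push_cast at r2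
  simp only [sqNorm]
  linear_combination -(2 * (n : ℝ) + 2 * α + 5) * r1 + (2 * (n : ℝ) + 2 * α + 3) * r2

/-- Starting at index `1` cancels the factor `2α + 1` of the usual closed form, which reads `0/0` at
`α = -1/2`. -/
theorem sqNorm_succ (α : ℝ) (hα : -1 / 2 ≤ α) (n : ℕ) :
    sqNorm α (n + 1) = sqNorm α 0 * ((n + 1).factorial : ℝ)
      / ((2 * (n : ℝ) + 2 * α + 3) * ∏ j ∈ Finset.range n, (2 * α + 2 + (j : ℝ))) := by
  induction n with
  | zero =>
    rw [← sqNorm_one α hα, eq_div_iff]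
    · simp; ring
    · simp; linarith
  | succ n ih =>
    have hn : (0 : ℝ) ≤ n := n.cast_nonneg
    have a : ((n : ℝ) + 2 * α + 2) * (2 * (n : ℝ) + 2 * α + 5) ≠ 0 :=
      mul_ne_zero (by linarith) (by linarith)
    have b : (2 * (n : ℝ) + 2 * α + 3) ≠ 0 := by linarith
    have d : ∏ j ∈ Finset.range n, (2 * α + 2 + (j : ℝ)) ≠ 0 :=
      Finset.prod_ne_zero_iff.2 fun j _ => by have : (0 : ℝ) ≤ j := j.cast_nonneg; linarith
    have r := sqNorm_succ_succ α hα n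
    rw [ih] at r
    refine mul_left_cancel₀ a (r.trans ?_)
    rw [Finset.prod_range_succ, Nat.factorial_succ (n + 1)]
    push_cast
    have a3 : (2 * ((n : ℝ) + 1) + 2 * α + 3) ≠ 0 := by linarith
    have a4 : (2 * α + 2 + (n : ℝ)) ≠ 0 := by linarith
    rw [mul_div_assoc', mul_div_assoc', div_eq_div_iff (mul_ne_zero b d)
      (mul_ne_zero a3 (mul_ne_zero d a4))]
    ring

theorem sqNorm_pos (α : ℝ) (hα : -1 / 2 ≤ α) (n : ℕ) : 0 < sqNorm α n := by
  have h0 : 0 < sqNorm α 0 := by rw [sqNorm_zero]; exact weightedIntegral_one_pos α hα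
  cases n with
  | zero => exact h0
  | succ n =>
    have hn : (0 : ℝ) ≤ n := n.cast_nonneg
    rw [sqNorm_succ α hα]
    refine div_pos (mul_pos h0 (by positivity)) (mul_pos (by linarith)
      (Finset.prod_pos fun j _ => ?_))
    have : (0 : ℝ) ≤ j := j.cast_nonneg
    linarith

/-! ### Total mass of the weight and growth of the inverse norms. -/

theorem integral_beta {a b : ℝ} (ha : 0 < a) (hb : 0 < b) :
    ∫ x in Set.Ioo (0 : ℝ) 1, x ^ (a - 1) * (1 - x) ^ (b - 1)
      = Real.Gamma a * Real.Gamma b / Real.Gamma (a + b) := by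
  change _ = ProbabilityTheory.beta a b
  rw [ProbabilityTheory.beta_eq_betaIntegralReal a b ha hb, Complex.betaIntegral,
    intervalIntegral.integral_of_le (by norm_num), ← MeasureTheory.integral_Ioc_eq_integral_Ioo,
    ← RCLike.re_to_complex, ← integral_re]
  · refine MeasureTheory.setIntegral_congr_fun measurableSet_Ioc fun x ⟨hx1, hx₂⟩ ↦ ?_
    norm_cast
    rw [← Complex.ofReal_cpow, ← Complex.ofReal_cpow, RCLike.re_to_complex,
      Complex.re_mul_ofReal, Complex.ofReal_re]
    all_goals linarith
  convert! Complex.betaIntegral_convergent (u := a) (v := b) (by simpa) (by simpa)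
  rw [intervalIntegrable_iff_integrableOn_Ioc_of_le (by simp), MeasureTheory.IntegrableOn]

/-- The substitution `s = (1 - cos θ)/2`, for which `s(1 - s) = (sin θ / 2)²`, yields the beta
integral `B(α+1, α+1)`. -/
theorem sqNorm_zero_eq (α : ℝ) (hα : -1 / 2 ≤ α) :
    sqNorm α 0 = 2 ^ (2 * α + 1) * Real.Gamma (α + 1) ^ 2 / Real.Gamma (2 * α + 2) := by
  have hb := integral_beta (a := α + 1) (b := α + 1) (by linarith) (by linarith)
  have himg : (fun θ => (1 - Real.cos θ) / 2) '' Set.Ioo 0 Real.pi = Set.Ioo (0 : ℝ) 1 := by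
    ext s
    constructor
    · rintro ⟨θ, hθ, rfl⟩
      have h1 := Real.cos_lt_cos_of_nonneg_of_le_pi le_rfl hθ.2.le hθ.1
      have h2 := Real.cos_lt_cos_of_nonneg_of_le_pi hθ.1.le le_rfl hθ.2
      rw [Real.cos_zero] at h1
      rw [Real.cos_pi] at h2
      constructor <;> dsimp only <;> linarith
    · intro hs
      refine ⟨Real.arccos (1 - 2 * s), ⟨Real.arccos_pos.2 (by linarith [hs.1]), ?_⟩, ?_⟩
      · refine lt_of_le_of_ne (Real.arccos_le_pi _) fun h => ?_
        have := Real.arccos_eq_pi.1 h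
        linarith [hs.2]
      · dsimp only
        rw [Real.cos_arccos (by linarith [hs.2]) (by linarith [hs.1])]
        ring
  have hinj : Set.InjOn (fun θ => (1 - Real.cos θ) / 2) (Set.Ioo 0 Real.pi) := by
    intro x hx y hy h
    refine Real.injOn_cos ⟨hx.1.le, hx.2.le⟩ ⟨hy.1.le, hy.2.le⟩ ?_
    dsimp only at h
    linarith
  have hder : ∀ θ ∈ Set.Ioo 0 Real.pi, HasDerivWithinAt (fun θ => (1 - Real.cos θ) / 2)
      (Real.sin θ / 2) (Set.Ioo 0 Real.pi) θ := fun θ _ => by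
    have := ((Real.hasDerivAt_cos θ).const_sub 1).div_const 2
    simpa using this.hasDerivWithinAt
  have hcv := MeasureTheory.integral_image_eq_integral_abs_deriv_smul measurableSet_Ioo hder hinj
    fun x => x ^ (α + 1 - 1) * (1 - x) ^ (α + 1 - 1)
  rw [himg, hb] at hcv
  rw [sqNorm_zero, weightedIntegral, intervalIntegral.integral_of_le Real.pi_pos.le,
    MeasureTheory.integral_Ioc_eq_integral_Ioo]
  have h2 : (∫ θ in Set.Ioo 0 Real.pi, 1 * Real.sin θ ^ (2 * α + 1))
      = ∫ θ in Set.Ioo 0 Real.pi, 2 ^ (2 * α + 1) * (|Real.sin θ / 2| •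
        (((1 - Real.cos θ) / 2) ^ (α + 1 - 1) * (1 - (1 - Real.cos θ) / 2) ^ (α + 1 - 1))) := by
    refine MeasureTheory.setIntegral_congr_fun measurableSet_Ioo fun θ hθ => ?_
    have hs := Real.sin_pos_of_pos_of_lt_pi hθ.1 hθ.2
    have hc := Real.abs_cos_le_one θ
    rw [← Real.mul_rpow (by linarith [(abs_le.1 hc).2]) (by linarith [(abs_le.1 hc).1]),
      show (1 - Real.cos θ) / 2 * (1 - (1 - Real.cos θ) / 2) = (Real.sin θ / 2) ^ (2 : ℝ) by
        rw [Real.rpow_two, div_pow, Real.sin_sq]; ring,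
      abs_of_pos (by positivity), smul_eq_mul, ← Real.rpow_mul (by positivity),
      mul_comm (Real.sin θ / 2), ← Real.rpow_add_one (by positivity),
      show 2 * (α + 1 - 1) + 1 = 2 * α + 1 by ring, Real.div_rpow hs.le (by norm_num)]
    field_simp
  rw [h2, MeasureTheory.integral_const_mul, ← hcv, show α + 1 + (α + 1) = 2 * α + 2 by ring]
  ring

/-- Growth of the Plancherel weights. -/
theorem tendsto_inv_sqNorm (α : ℝ) (hα : -1 / 2 ≤ α) :
    Tendsto (fun n : ℕ => (sqNorm α n)⁻¹ / (n : ℝ) ^ (2 * α + 1)) atTop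
      (nhds (2 / (2 ^ (2 * α + 1) * Real.Gamma (α + 1) ^ 2))) := by
  rw [← tendsto_add_atTop_iff_nat 1]
  have hG : 0 < Real.Gamma (2 * α + 2) := Real.Gamma_pos_of_pos (by linarith)
  have hW := sqNorm_pos α hα 0
  -- Euler's limit for `Γ(2α+2)` absorbs the factorial and the product in `sqNorm_succ`; `h2` and
  -- `h4` correct the remaining elementary factors.
  have h1 := (Real.GammaSeq_tendsto_Gamma (2 * α + 2)).inv₀ hG.ne'
  have h2 : Tendsto (fun n : ℕ => (2 * (n : ℝ) + 2 * α + 3) / ((n : ℝ) + 2 * α + 2)) atTop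
      (nhds 2) := by
    have h3 : Tendsto (fun n : ℕ => 2 - (2 * α + 1) / ((n : ℝ) + (2 * α + 2))) atTop
        (nhds (2 - 0)) :=
      tendsto_const_nhds.sub (tendsto_const_nhds.div_atTop
        (tendsto_atTop_add_const_right _ _ tendsto_natCast_atTop_atTop))
    rw [sub_zero] at h3
    refine h3.congr fun n => ?_
    have hn : (0 : ℝ) ≤ n := n.cast_nonneg
    have : (n : ℝ) + 2 * α + 2 ≠ 0 := by linarith
    rw [← add_assoc, eq_div_iff this, sub_mul, div_mul_cancel₀ _ this]
    ring
  have h4 : Tendsto (fun n : ℕ => ((n : ℝ) / ((n : ℝ) + 1)) ^ (2 * α + 2)) atTop (nhds 1) := by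
    have := (tendsto_natCast_div_add_atTop (1 : ℝ)).rpow_const (p := 2 * α + 2)
      (Or.inl one_ne_zero)
    simpa using this
  have h5 := ((h1.mul h2).mul h4).const_mul (sqNorm α 0)⁻¹
  have e : (sqNorm α 0)⁻¹ * ((Real.Gamma (2 * α + 2))⁻¹ * 2 * 1)
      = 2 / (2 ^ (2 * α + 1) * Real.Gamma (α + 1) ^ 2) := by
    rw [sqNorm_zero_eq α hα]
    generalize Real.Gamma (2 * α + 2) = g at hG
    have : 0 < Real.Gamma (α + 1) := Real.Gamma_pos_of_pos (by linarith)
    field_simp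
  rw [e] at h5
  refine h5.congr' ?_
  filter_upwards [eventually_gt_atTop 0] with n hn
  have hn0 : (0 : ℝ) < n := by exact_mod_cast hn
  rw [sqNorm_succ α hα, Real.GammaSeq, Finset.prod_range_succ, Nat.factorial_succ,
    Real.div_rpow hn0.le (by positivity), Nat.cast_succ,
    show (2 * α + 2) = (2 * α + 1) + 1 by ring, Real.rpow_add_one (x := (n : ℝ) + 1) (by positivity)]
  have hp : 0 < ∏ j ∈ Finset.range n, (2 * α + 1 + 1 + (j : ℝ)) :=
    Finset.prod_pos fun j _ => by have : (0 : ℝ) ≤ j := j.cast_nonneg; linarith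
  have q1 : (n : ℝ) + (2 * α + 1 + 1) ≠ 0 := by linarith
  have q2 : (2 * α + 1 + 1) + (n : ℝ) ≠ 0 := by linarith
  have q3 : 2 * (n : ℝ) + 2 * α + 3 ≠ 0 := by linarith
  have q4 : (n : ℝ) + 2 * α + 2 ≠ 0 := by linarith
  have q5 : (n : ℝ) ^ (2 * α + 1 + 1) ≠ 0 := (Real.rpow_pos_of_pos hn0 _).ne'
  have q6 : ((n : ℝ) + 1) ^ (2 * α + 1) ≠ 0 := (Real.rpow_pos_of_pos (by linarith) _).ne'
  have q7 : (n.factorial : ℝ) ≠ 0 := by exact_mod_cast n.factorial_ne_zero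
  push_cast
  field_simp
  ring

/-! ### Linearization coefficients as integrals; Parseval's identity. -/

theorem weightedIntegral_sum_mul (α : ℝ) (hα : -1 / 2 ≤ α) (s : Finset ℕ) (c : ℕ → ℝ)
    {g : ℝ → ℝ} (hg : Continuous g) :
    weightedIntegral α (fun θ => (∑ i ∈ s, c i * gegenbauerCos α i θ) * g θ)
      = ∑ i ∈ s, c i * weightedIntegral α (fun θ => gegenbauerCos α i θ * g θ) := by
  simp only [← weightedIntegral_const_mul, Finset.sum_mul, mul_assoc]
  exact weightedIntegral_finset_sum α hα s fun i => by
    have := continuous_gegenbauerCos α i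
    fun_prop

theorem weightedIntegral_sum_mul_gegenbauerCos (α : ℝ) (hα : -1 / 2 ≤ α) (s : Finset ℕ)
    (c : ℕ → ℝ) (k : ℕ) (hk : k ∉ s → c k = 0) :
    weightedIntegral α (fun θ => (∑ i ∈ s, c i * gegenbauerCos α i θ) * gegenbauerCos α k θ)
      = c k * sqNorm α k := by
  rw [weightedIntegral_sum_mul α hα s c (continuous_gegenbauerCos α k)]
  refine Finset.sum_eq_single k (fun i _ hi => ?_) fun h => ?_
  · rw [weightedIntegral_gegenbauerCos_mul α hα hi, mul_zero]
  · rw [hk h, zero_mul]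

theorem eval_eq_sum_repr (α : ℝ) (hα : -1 / 2 ≤ α) (p : ℝ[X]) (θ : ℝ) :
    p.eval (Real.cos θ) = ∑ i ∈ ((gegenbauerBasis α hα).repr p).support,
      (gegenbauerBasis α hα).repr p i * gegenbauerCos α i θ := by
  conv_lhs => rw [← (gegenbauerBasis α hα).linearCombination_repr p, Finsupp.linearCombination_apply,
    Finsupp.sum, eval_finsetSum]
  refine Finset.sum_congr rfl fun i _ => ?_
  rw [gegenbauerBasis_apply, eval_smul, smul_eq_mul, gegenbauerCos]

theorem linCoeff_eq (α : ℝ) (hα : -1 / 2 ≤ α) (m n k : ℕ) :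
    linCoeff α hα m n k = (sqNorm α k)⁻¹ * weightedIntegral α
      (fun θ => gegenbauerCos α m θ * gegenbauerCos α n θ * gegenbauerCos α k θ) := by
  have h := weightedIntegral_sum_mul_gegenbauerCos α hα
    ((gegenbauerBasis α hα).repr (gegenbauer α m * gegenbauer α n)).support
    ((gegenbauerBasis α hα).repr (gegenbauer α m * gegenbauer α n)) k
    Finsupp.notMem_support_iff.1
  simp only [← eval_eq_sum_repr, eval_mul] at h
  rw [linCoeff, eq_inv_mul_iff_mul_eq₀ (sqNorm_pos α hα k).ne', mul_comm, ← h]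
  rfl

/-- The squared distance of `f` to a linear combination of Gegenbauer polynomials. -/
theorem weightedIntegral_sub_sum_sq (α : ℝ) (hα : -1 / 2 ≤ α) (s : Finset ℕ) (c : ℕ → ℝ)
    {f : ℝ → ℝ} (hf : Continuous f) :
    weightedIntegral α (fun θ => (f θ - ∑ i ∈ s, c i * gegenbauerCos α i θ) ^ 2)
      = weightedIntegral α (fun θ => f θ * f θ)
        - ∑ i ∈ s, (2 * c i * weightedIntegral α (fun θ => gegenbauerCos α i θ * f θ)
          - c i ^ 2 * sqNorm α i) := by
  have hq : Continuous fun θ => ∑ i ∈ s, c i * gegenbauerCos α i θ :=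
    continuous_finsetSum _ fun i _ => continuous_const.mul (continuous_gegenbauerCos α i)
  have e1 := weightedIntegral_sum_mul α hα s c hf
  have e2 := weightedIntegral_sum_mul α hα s c hq
  have e3 : ∀ i ∈ s, weightedIntegral α
      (fun θ => gegenbauerCos α i θ * ∑ j ∈ s, c j * gegenbauerCos α j θ) = c i * sqNorm α i := by
    intro i hi
    rw [← weightedIntegral_sum_mul_gegenbauerCos α hα s c i fun h => absurd hi h]
    simp only [mul_comm]
  rw [Finset.sum_congr rfl fun i hi => by rw [e3 i hi]] at e2
  have e : ∀ θ, (f θ - ∑ i ∈ s, c i * gegenbauerCos α i θ) ^ 2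
      = f θ * f θ - (2 * ((∑ i ∈ s, c i * gegenbauerCos α i θ) * f θ)
        - (∑ i ∈ s, c i * gegenbauerCos α i θ) * ∑ i ∈ s, c i * gegenbauerCos α i θ) :=
    fun θ => by ring
  simp only [e]
  rw [weightedIntegral_sub α hα (by fun_prop) (by fun_prop),
    weightedIntegral_sub α hα (by fun_prop) (by fun_prop), weightedIntegral_const_mul, e1, e2,
    Finset.sum_sub_distrib, Finset.mul_sum]
  congr 2
  · exact Finset.sum_congr rfl fun i _ => by ring
  · exact Finset.sum_congr rfl fun i _ => by ring

/-- Bessel's inequality bounds the partial sums. They reach the full value because polynomials in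
`cos θ` are uniformly dense on `[0, π]` and the Fourier coefficients minimise the mean square
distance. -/
theorem hasSum_sq_gegenbauer (α : ℝ) (hα : -1 / 2 ≤ α) {f : ℝ → ℝ} (hf : Continuous f) :
    HasSum (fun k => (sqNorm α k)⁻¹ * weightedIntegral α (fun θ => gegenbauerCos α k θ * f θ) ^ 2)
      (weightedIntegral α fun θ => f θ * f θ) := by
  refine hasSum_of_isLUB_of_nonneg _
    (fun k => mul_nonneg (inv_nonneg.2 (sqNorm_pos α hα k).le) (sq_nonneg _)) ⟨?_, ?_⟩
  · rintro _ ⟨s, rfl⟩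
    have h := weightedIntegral_sub_sum_sq α hα s
      (fun k => (sqNorm α k)⁻¹ * weightedIntegral α (fun θ => gegenbauerCos α k θ * f θ)) hf
    have h0 : 0 ≤ weightedIntegral α (fun θ => (f θ - ∑ i ∈ s, ((sqNorm α i)⁻¹ *
        weightedIntegral α (fun θ => gegenbauerCos α i θ * f θ)) * gegenbauerCos α i θ) ^ 2) :=
      intervalIntegral.integral_nonneg Real.pi_pos.le fun θ hθ => mul_nonneg (sq_nonneg _)
        (Real.rpow_nonneg (Real.sin_nonneg_of_nonneg_of_le_pi hθ.1 hθ.2) _)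
    rw [h, sub_nonneg] at h0
    refine le_trans (le_of_eq (Finset.sum_congr rfl fun i _ => ?_)) h0
    have := (sqNorm_pos α hα i).ne'
    field_simp
    ring
  · intro b hb
    have hW := weightedIntegral_one_pos α hα
    refine le_of_forall_pos_le_add fun ε hε => ?_
    set W := weightedIntegral α fun _ => 1 with hWdef
    -- A uniform error `√(ε/W)` has squared norm at most `ε`, as `W` is the mass of the weight.
    -- Composing with `arccos` makes Weierstrass applicable on `[-1, 1]`.
    obtain ⟨p, hp⟩ := exists_polynomial_near_of_continuousOn (-1) 1 (fun t => f (Real.arccos t))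
      (hf.comp Real.continuous_arccos).continuousOn (√(ε / W)) (by positivity)
    set c := (gegenbauerBasis α hα).repr p with hc
    have h := weightedIntegral_sub_sum_sq α hα c.support c hf
    have hle : weightedIntegral α
        (fun θ => (f θ - ∑ i ∈ c.support, c i * gegenbauerCos α i θ) ^ 2) ≤ ε := by
      have hq : Continuous fun θ => ∑ i ∈ c.support, c i * gegenbauerCos α i θ :=
        continuous_finsetSum _ fun i _ => continuous_const.mul (continuous_gegenbauerCos α i)
      calc _ ≤ weightedIntegral α fun _ => (ε / W) * 1 := by
            refine weightedIntegral_mono α hα (by fun_prop) (by fun_prop) fun θ hθ => ?_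
            rw [hc, ← eval_eq_sum_repr]
            have h1 := hp (Real.cos θ) (Real.cos_mem_Icc θ)
            rw [Real.arccos_cos hθ.1 hθ.2, abs_sub_comm] at h1
            rw [← sq_abs, mul_one, ← Real.sq_sqrt (by positivity : 0 ≤ ε / W)]
            exact pow_le_pow_left₀ (abs_nonneg _) h1.le 2
        _ = ε := by
            rw [weightedIntegral_const_mul, ← hWdef, div_mul_cancel₀ _ hW.ne']
    rw [h] at hle
    have hb' := hb ⟨c.support, rfl⟩
    have hs : ∑ i ∈ c.support, (2 * c i * weightedIntegral α (fun θ => gegenbauerCos α i θ * f θ)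
          - c i ^ 2 * sqNorm α i) ≤ ∑ k ∈ c.support,
          (sqNorm α k)⁻¹ * weightedIntegral α (fun θ => gegenbauerCos α k θ * f θ) ^ 2 := by
      refine Finset.sum_le_sum fun i _ => ?_
      have hN := sqNorm_pos α hα i
      generalize weightedIntegral α (fun θ => gegenbauerCos α i θ * f θ) = a
      rw [inv_mul_eq_div, le_div_iff₀ hN]
      nlinarith [sq_nonneg (a - c i * sqNorm α i)]
    dsimp only at hb'
    linarith

/-- Parseval's identity for the Gegenbauer polynomials. -/
theorem hasSum_mul_gegenbauer (α : ℝ) (hα : -1 / 2 ≤ α) {f g : ℝ → ℝ} (hf : Continuous f)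
    (hg : Continuous g) :
    HasSum (fun k => (sqNorm α k)⁻¹ * weightedIntegral α (fun θ => gegenbauerCos α k θ * f θ)
        * weightedIntegral α (fun θ => gegenbauerCos α k θ * g θ))
      (weightedIntegral α fun θ => f θ * g θ) := by
  have h1 := hasSum_sq_gegenbauer α hα (hf.add hg)
  have h2 := hasSum_sq_gegenbauer α hα (hf.sub hg)
  have h := (h1.sub h2).mul_left (1 / 4)
  have e0 : ∀ k, weightedIntegral α (fun θ => gegenbauerCos α k θ * (f θ + g θ))
      = weightedIntegral α (fun θ => gegenbauerCos α k θ * f θ)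
        + weightedIntegral α (fun θ => gegenbauerCos α k θ * g θ) := fun k => by
    have := continuous_gegenbauerCos α k
    rw [← weightedIntegral_add α hα (by fun_prop) (by fun_prop)]
    simp only [mul_add]
  have e1 : ∀ k, weightedIntegral α (fun θ => gegenbauerCos α k θ * (f θ - g θ))
      = weightedIntegral α (fun θ => gegenbauerCos α k θ * f θ)
        - weightedIntegral α (fun θ => gegenbauerCos α k θ * g θ) := fun k => by
    have := continuous_gegenbauerCos α k
    rw [← weightedIntegral_sub α hα (by fun_prop) (by fun_prop)]
    simp only [mul_sub]
  convert! h using 1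
  · funext k
    simp only [Pi.add_apply, Pi.sub_apply, e0, e1]
    ring
  · simp only [Pi.add_apply, Pi.sub_apply]
    rw [← weightedIntegral_sub α hα (by fun_prop) (by fun_prop), ← weightedIntegral_const_mul]
    congr 1
    funext θ
    ring

/-! ### The transform of `μ` and the spectral representation. -/

theorem summable_toReal_pmf (μ : PMF ℕ) : Summable fun k => (μ k).toReal :=
  ENNReal.summable_toReal μ.tsum_coe_ne_top

theorem tsum_toReal_pmf (μ : PMF ℕ) : ∑' k, (μ k).toReal = 1 := by
  rw [← ENNReal.tsum_toReal_eq fun k => μ.apply_ne_top k, μ.tsum_coe, ENNReal.toReal_one]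

/-- The Gegenbauer transform of `μ`, in the angular variable. -/
noncomputable def transform (α : ℝ) (μ : PMF ℕ) (θ : ℝ) : ℝ :=
  ∑' k, (μ k).toReal * gegenbauerCos α k θ

theorem norm_toReal_mul_gegenbauerCos_le (α : ℝ) (hα : -1 / 2 ≤ α) (μ : PMF ℕ) (k : ℕ) (θ : ℝ) :
    ‖(μ k).toReal * gegenbauerCos α k θ‖ ≤ (μ k).toReal := by
  rw [norm_mul, Real.norm_of_nonneg ENNReal.toReal_nonneg]
  exact mul_le_of_le_one_right ENNReal.toReal_nonneg (abs_gegenbauerCos_le_one α hα k θ)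

theorem hasSum_transform (α : ℝ) (hα : -1 / 2 ≤ α) (μ : PMF ℕ) (θ : ℝ) :
    HasSum (fun k => (μ k).toReal * gegenbauerCos α k θ) (transform α μ θ) :=
  (Summable.of_norm_bounded (summable_toReal_pmf μ)
    fun k => norm_toReal_mul_gegenbauerCos_le α hα μ k θ).hasSum

theorem continuous_transform (α : ℝ) (hα : -1 / 2 ≤ α) (μ : PMF ℕ) :
    Continuous (transform α μ) :=
  continuous_tsum (fun k => continuous_const.mul (continuous_gegenbauerCos α k))
    (summable_toReal_pmf μ) fun k θ => norm_toReal_mul_gegenbauerCos_le α hα μ k θ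

/-- Only pairs with first coordinate `x` survive in the convolution; averaging `linCoeff_eq` over
`μ` puts the transform under the integral, by dominated convergence with `|P_k| ≤ 1`. -/
theorem step_eq (α : ℝ) (hα : -1 / 2 ≤ α) (μ : PMF ℕ) (x y : ℕ) :
    step α hα μ x y = (sqNorm α y)⁻¹ * weightedIntegral α
      (fun θ => gegenbauerCos α x θ * (transform α μ θ * gegenbauerCos α y θ)) := by
  have h1 : step α hα μ x y = ∑' k, (μ k).toReal * linCoeff α hα x k y := by
    rw [step, conv, ← Function.Injective.tsum_eq (g := fun k : ℕ => (x, k))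
      (fun a b h => (Prod.mk.inj h).2)]
    · simp
    · rintro ⟨a, k⟩ h
      refine ⟨k, ?_⟩
      by_contra hne
      have hax : a ≠ x := fun h => hne (by rw [h])
      simp [hax] at h
  have h2 : HasSum (fun k => weightedIntegral α fun θ => (μ k).toReal * gegenbauerCos α k θ *
      (gegenbauerCos α x θ * gegenbauerCos α y θ))
      (weightedIntegral α fun θ => transform α μ θ *
        (gegenbauerCos α x θ * gegenbauerCos α y θ)) := by
    have cx := continuous_gegenbauerCos α x
    have cy := continuous_gegenbauerCos α y
    have cw := continuous_weight α hα
    refine intervalIntegral.hasSum_integral_of_dominated_convergence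
      (fun k θ => (μ k).toReal * |Real.sin θ ^ (2 * α + 1)|) (fun k => ?_) (fun k => ?_) ?_ ?_ ?_
    · have ck := continuous_gegenbauerCos α k
      exact Continuous.aestronglyMeasurable (by fun_prop)
    · refine Eventually.of_forall fun θ _ => ?_
      rw [norm_mul, norm_mul, Real.norm_eq_abs (_ ^ _)]
      refine mul_le_mul_of_nonneg_right ?_ (abs_nonneg _)
      refine (mul_le_of_le_one_right (norm_nonneg _) ?_).trans
        (norm_toReal_mul_gegenbauerCos_le α hα μ k θ)
      rw [norm_mul]
      exact mul_le_one₀ (abs_gegenbauerCos_le_one α hα x θ) (norm_nonneg _)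
        (abs_gegenbauerCos_le_one α hα y θ)
    · exact Eventually.of_forall fun θ _ => (summable_toReal_pmf μ).mul_right _
    · simp only [tsum_mul_right]
      exact (by fun_prop : Continuous fun θ => (∑' k, (μ k).toReal) *
        |Real.sin θ ^ (2 * α + 1)|).intervalIntegrable _ _
    · exact Eventually.of_forall fun θ _ => ((hasSum_transform α hα μ θ).mul_right _).mul_right _
  rw [h1]
  have h3 := h2.mul_left (sqNorm α y)⁻¹
  convert h3.tsum_eq using 1
  · congr 1
    funext k
    rw [linCoeff_eq, mul_left_comm, ← weightedIntegral_const_mul]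
    congr 2
    funext θ
    ring
  · congr 2
    funext θ
    ring

/-- Spectral representation of the `n`-step transition probabilities. -/
theorem nStep_eq (α : ℝ) (hα : -1 / 2 ≤ α) (μ : PMF ℕ) (n x y : ℕ) :
    nStep α hα μ n x y = (sqNorm α y)⁻¹ * weightedIntegral α
      (fun θ => transform α μ θ ^ n * gegenbauerCos α x θ * gegenbauerCos α y θ) := by
  induction n generalizing y with
  | zero =>
    simp only [nStep, pow_zero, one_mul]
    split_ifs with h
    · subst h
      exact (inv_mul_cancel₀ (sqNorm_pos α hα x).ne').symm
    · rw [weightedIntegral_gegenbauerCos_mul α hα h, mul_zero]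
  | succ n ih =>
    have ct := continuous_transform α hα μ
    have cx := continuous_gegenbauerCos α x
    have cy := continuous_gegenbauerCos α y
    -- The sum over the intermediate state `z` is Parseval's identity for `φ^n P_x` and `φ P_y`.
    have h := (hasSum_mul_gegenbauer α hα
      (f := fun θ => transform α μ θ ^ n * gegenbauerCos α x θ)
      (g := fun θ => transform α μ θ * gegenbauerCos α y θ) (by fun_prop) (by fun_prop)).mul_left
      (sqNorm α y)⁻¹
    rw [nStep]
    convert h.tsum_eq using 1
    · congr 1
      funext z
      rw [ih, step_eq]
      simp only [mul_comm (gegenbauerCos α z _) (transform α μ _ ^ n * _)]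
      ring
    · congr 2
      funext θ
      ring

/-! ### Aperiodicity and the modulus of the transform. -/

theorem gegenbauerCos_zero_right (α : ℝ) (hα : -1 < α) (n : ℕ) : gegenbauerCos α n 0 = 1 := by
  rw [gegenbauerCos, Real.cos_zero, gegenbauer_eval_one α hα]

theorem transform_zero (α : ℝ) (hα : -1 < α) (μ : PMF ℕ) : transform α μ 0 = 1 := by
  simp only [transform, gegenbauerCos_zero_right α hα, mul_one, tsum_toReal_pmf]

theorem abs_transform_le_one (α : ℝ) (hα : -1 / 2 ≤ α) (μ : PMF ℕ) (θ : ℝ) :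
    |transform α μ θ| ≤ 1 := by
  rw [← tsum_toReal_pmf μ]
  exact tsum_of_norm_bounded (summable_toReal_pmf μ).hasSum
    fun k => norm_toReal_mul_gegenbauerCos_le α hα μ k θ

/-- An average of numbers in `[-1, 1]` is extremal only if every number carrying mass is: the
nonnegative terms `μ(k)(1 - ε P_k)` sum to zero. -/
theorem gegenbauerCos_eq_of_transform_eq (α : ℝ) (hα : -1 / 2 ≤ α) (μ : PMF ℕ) (θ ε : ℝ)
    (hε : |ε| = 1) (h : transform α μ θ = ε) : ∀ k ∈ μ.support, gegenbauerCos α k θ = ε := by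
  have hεε : ε * ε = 1 := by rw [← sq, ← sq_abs, hε, one_pow]
  have h1 := ((summable_toReal_pmf μ).hasSum).sub ((hasSum_transform α hα μ θ).mul_left ε)
  rw [tsum_toReal_pmf, h, hεε, sub_self, hasSum_zero_iff_of_nonneg] at h1
  · intro k hk
    have h2 := congrFun h1 k
    have hk0 : (μ k).toReal ≠ 0 :=
      ENNReal.toReal_ne_zero.2 ⟨(PMF.mem_support_iff μ k).1 hk, μ.apply_ne_top k⟩
    have h3 : (μ k).toReal * (1 - ε * gegenbauerCos α k θ) = 0 := by
      rw [Pi.zero_apply] at h2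
      linear_combination h2
    have h4 := (mul_eq_zero.1 h3).resolve_left hk0
    linear_combination -ε * h4 - gegenbauerCos α k θ * hεε
  · intro k
    have h2 : |ε * gegenbauerCos α k θ| ≤ 1 := by
      rw [abs_mul, hε, one_mul]; exact abs_gegenbauerCos_le_one α hα k θ
    have h3 : 0 ≤ (μ k).toReal * (1 - ε * gegenbauerCos α k θ) :=
      mul_nonneg ENNReal.toReal_nonneg (by linarith [(abs_le.1 h2).2])
    change 0 ≤ (μ k).toReal - ε * ((μ k).toReal * gegenbauerCos α k θ)
    linarith

theorem gegenbauerCos_neg_half (k : ℕ) (θ : ℝ) :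
    gegenbauerCos (-1 / 2) k θ = Real.cos (k * θ) := by
  induction k using Nat.twoStepInduction with
  | zero => simp [gegenbauerCos_zero]
  | one => simp [gegenbauerCos_one]
  | more n h0 h1 =>
    have r := gegenbauerCos_recurrence (-1 / 2) (by norm_num) n θ
    have hn : (n : ℝ) + 1 ≠ 0 := by positivity
    rw [h0, h1] at r
    have e1 : ((n + 2 : ℕ) : ℝ) * θ = ((n + 1 : ℕ) : ℝ) * θ + θ := by push_cast; ring
    have e2 : (n : ℝ) * θ = ((n + 1 : ℕ) : ℝ) * θ - θ := by push_cast; ring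
    rw [e2, Real.cos_sub] at r
    rw [e1, Real.cos_add]
    refine mul_left_cancel₀ hn ?_
    linear_combination -r

theorem cos_natCast_mul_eq_one_iff (k : ℕ) (θ : ℝ) :
    Real.cos (k * θ) = 1 ↔ addOrderOf (θ : Real.Angle) ∣ k := by
  rw [addOrderOf_dvd_iff_nsmul_eq_zero, ← Real.Angle.natCast_mul_eq_nsmul, ← Real.Angle.coe_zero,
    Real.Angle.angle_eq_iff_two_pi_dvd_sub, Real.cos_eq_one_iff]
  simp only [sub_zero, eq_comm, mul_comm]

/-- If `|φ(θ)| = 1`, all `P_k(cos θ)` with `k` in the support equal one sign. For `α > -1/2` an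
interior `θ` forces support `{0}`, and `θ = π` fixes the parity of the support. For `α = -1/2` the
values are `cos kθ`, and the order `d` of `θ` modulo `2π` supplies the forbidden lattice. -/
theorem abs_transform_lt_one (α : ℝ) (hα : -1 / 2 ≤ α) (μ : PMF ℕ) (hμ : IsAperiodic α μ) {θ : ℝ}
    (h0 : 0 < θ) (hπ : θ ≤ Real.pi) : |transform α μ θ| < 1 := by
  obtain ⟨he, ho, hd⟩ := hμ
  refine lt_of_le_of_ne (abs_transform_le_one α hα μ θ) fun h1 => ?_
  have key := gegenbauerCos_eq_of_transform_eq α hα μ θ _ h1 rfl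
  generalize transform α μ θ = ε at h1 key
  rcases eq_or_lt_of_le hα with hα' | hα'
  · rw [← hα'] at key
    simp only [gegenbauerCos_neg_half] at key
    have hd' := hd hα'.symm
    set d := addOrderOf (θ : Real.Angle) with hddef
    have hd1 : d ≠ 1 := fun h => by
      have := (cos_natCast_mul_eq_one_iff 1 θ).2 (by rw [← hddef, h])
      rw [Nat.cast_one, one_mul, Real.cos_eq_one_iff_of_lt_of_lt (by linarith) (by linarith)] at this
      exact h0.ne' this
    rcases eq_or_eq_neg_of_abs_eq h1 with rfl | rfl
    · have hdvd : ∀ k ∈ μ.support, d ∣ k := fun k hk =>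
        (cos_natCast_mul_eq_one_iff k θ).1 (key k hk)
      rcases Nat.lt_or_ge d 2 with h2 | h2
      -- `d = 0` encodes infinite order; then `d ∣ k` means `k = 0`, and the support `{0}` is even.
      · have hd0 : d = 0 := by omega
        refine he fun k hk => ?_
        have := hdvd k hk
        rw [hd0, zero_dvd_iff] at this
        simp [this]
      · exact hd' d h2 hdvd
    -- When `cos kθ = -1`, `kθ` has order two. An odd `d` is impossible; for `d = 2e` the support
    -- lies in `eℕ`, with `e = 0` absurd and `e = 1` making every `k` odd.
    · have hdvd : ∀ k ∈ μ.support, d ∣ 2 * k ∧ ¬ d ∣ k := fun k hk => by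
        have h2 := key k hk
        refine ⟨(cos_natCast_mul_eq_one_iff (2 * k) θ).1 ?_, fun h => ?_⟩
        · rw [Nat.cast_mul, Nat.cast_ofNat, mul_assoc, Real.cos_two_mul, h2]
          norm_num
        · have := (cos_natCast_mul_eq_one_iff k θ).2 h
          rw [h2] at this
          norm_num at this
      rcases Nat.even_or_odd d with ⟨e, hde⟩ | hodd
      · have hek : ∀ k ∈ μ.support, e ∣ k := fun k hk => by
          have := (hdvd k hk).1
          rw [hde, ← two_mul] at this
          exact Nat.dvd_of_mul_dvd_mul_left two_pos this
        rcases Nat.lt_or_ge e 2 with h2 | h2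
        · refine ho fun k hk => ?_
          have hk2 := (hdvd k hk).2
          have hk1 := hek k hk
          have : e = 0 ∨ e = 1 := by omega
          rcases this with rfl | rfl
          · rw [zero_dvd_iff] at hk1
            rw [hk1] at hk2
            exact absurd (dvd_zero d) hk2
          · rw [hde] at hk2
            exact Nat.not_even_iff_odd.1 fun h => hk2 h.two_dvd
        · exact hd' e h2 hek
      · obtain ⟨k, hk⟩ := μ.support_nonempty
        exact (hdvd k hk).2
          ((Nat.Coprime.dvd_mul_left (Nat.coprime_two_right.2 hodd)).1 (hdvd k hk).1)
  · rcases eq_or_lt_of_le hπ with rfl | hπ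
    · have hpi : ∀ k, gegenbauerCos α k Real.pi = (-1) ^ k := fun k => by
        rw [gegenbauerCos, Real.cos_pi, gegenbauer_eval_neg, gegenbauer_eval_one α (by linarith),
          mul_one]
      simp only [hpi] at key
      rcases eq_or_eq_neg_of_abs_eq h1 with rfl | rfl
      · exact he fun k hk => (neg_one_pow_eq_one_iff_even (by norm_num)).1 (key k hk)
      · exact ho fun k hk => (neg_one_pow_eq_neg_one_iff_odd (by norm_num)).1 (key k hk)
    · refine he fun k hk => ?_
      by_contra hk2
      have hk0 : k ≠ 0 := by rintro rfl; exact hk2 Even.zero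
      have hcos : |Real.cos θ| < 1 := by
        have c1 := Real.cos_lt_cos_of_nonneg_of_le_pi le_rfl hπ.le h0
        have c2 := Real.cos_lt_cos_of_nonneg_of_le_pi h0.le le_rfl hπ
        rw [Real.cos_zero] at c1
        rw [Real.cos_pi] at c2
        exact abs_lt.2 ⟨c2, c1⟩
      have := abs_gegenbauer_eval_lt_one α hα' k hk0 hcos
      have e := key k hk
      rw [gegenbauerCos] at e
      rw [e, h1] at this
      exact lt_irrefl _ this

/-! ### Behaviour of the transform at `0` and its Gaussian bound. -/

theorem summable_diffConst (α : ℝ) (hα : -1 / 2 ≤ α) (μ : PMF ℕ)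
    (hmom : Summable fun n : ℕ => (μ n).toReal * (n : ℝ) ^ 2) :
    Summable fun n : ℕ => (μ n).toReal * ((n : ℝ) * ((n : ℝ) + 2 * α + 1)) := by
  refine Summable.of_nonneg_of_le (fun n => ?_) (fun n => ?_) (hmom.mul_left (2 * α + 2))
  · have hn : (0 : ℝ) ≤ n := n.cast_nonneg
    exact mul_nonneg ENNReal.toReal_nonneg (mul_nonneg hn (by linarith))
  · rw [mul_left_comm (2 * α + 2)]
    refine mul_le_mul_of_nonneg_left ?_ ENNReal.toReal_nonneg
    have h1 : (n : ℝ) ≤ (n : ℝ) ^ 2 := by exact_mod_cast Nat.le_self_pow two_ne_zero n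
    have : 0 ≤ 2 * α + 1 := by linarith
    nlinarith

theorem diffConst_pos (α : ℝ) (hα : -1 / 2 ≤ α) (μ : PMF ℕ) (hμ : IsAperiodic α μ)
    (hmom : Summable fun n : ℕ => (μ n).toReal * (n : ℝ) ^ 2) : 0 < diffConst α μ := by
  obtain ⟨k, hk, hk2⟩ := Set.not_subset.1 hμ.1
  have hk0 : k ≠ 0 := by rintro rfl; exact hk2 Even.zero
  have hk0' : (0 : ℝ) < k := by exact_mod_cast Nat.pos_of_ne_zero hk0
  refine mul_pos (one_div_pos.2 (by linarith)) ?_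
  refine (summable_diffConst α hα μ hmom).tsum_pos (fun n => ?_) k ?_
  · have hn : (0 : ℝ) ≤ n := n.cast_nonneg
    exact mul_nonneg ENNReal.toReal_nonneg (mul_nonneg hn (by linarith))
  · refine mul_pos (ENNReal.toReal_pos ((PMF.mem_support_iff μ k).1 hk) (μ.apply_ne_top k))
      (mul_pos hk0' (by linarith))

theorem abs_one_sub_gegenbauer_eval_le (α : ℝ) (hα : -1 / 2 ≤ α) (n : ℕ) {x : ℝ}
    (hx : |x| ≤ 1) : |1 - (gegenbauer α n).eval x|
      ≤ (n : ℝ) * ((n : ℝ) + 2 * α + 1) / (2 * (α + 1)) * (1 - x) := by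
  have hx' := abs_le.1 hx
  have h := Convex.norm_image_sub_le_of_norm_hasDerivWithin_le
    (f := fun x => (gegenbauer α n).eval x) (s := Set.Icc (-1 : ℝ) 1)
    (fun y _ => ((gegenbauer α n).hasDerivAt y).hasDerivWithinAt)
    (fun y hy => abs_derivative_gegenbauer_eval_le α hα n (abs_le.2 hy)) (convex_Icc _ _)
    (show x ∈ Set.Icc (-1 : ℝ) 1 from hx') (show (1 : ℝ) ∈ Set.Icc (-1 : ℝ) 1 by norm_num)
  rw [gegenbauer_eval_one α (by linarith), Real.norm_eq_abs, Real.norm_eq_abs,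
    abs_of_nonneg (by linarith : 0 ≤ 1 - x)] at h
  exact h

theorem tendsto_one_sub_cos_div_sq :
    Tendsto (fun θ : ℝ => (1 - Real.cos θ) / θ ^ 2) (nhdsWithin 0 {0}ᶜ) (nhds (1 / 2)) := by
  have h1 : Tendsto (fun θ : ℝ => Real.sinc (θ / 2)) (nhdsWithin 0 {0}ᶜ) (nhds 1) := by
    have : Continuous fun θ : ℝ => Real.sinc (θ / 2) := by fun_prop
    simpa using (this.tendsto 0).mono_left nhdsWithin_le_nhds
  have h2 := (h1.pow 2).const_mul (1 / 2)
  rw [one_pow, mul_one] at h2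
  refine h2.congr' ?_
  filter_upwards [self_mem_nhdsWithin] with θ hθ
  have hθ' : θ ≠ 0 := hθ
  rw [Real.sinc_of_ne_zero (by simpa using hθ'),
    show 1 - Real.cos θ = 2 * Real.sin (θ / 2) ^ 2 by
      rw [Real.sin_sq_eq_half_sub, mul_div_cancel₀ θ two_ne_zero]; ring]
  field_simp

/-- Dividing by `1 - cos θ` first turns each term into a difference quotient of `P_k` at `1`, with
limit and bound `P_k'(1) = k(k+2α+1)/(2(α+1))`; the second moment makes this summable. The ratio `(1
- cos θ)/θ² → 1/2` supplies the rest of `C`. -/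
theorem tendsto_one_sub_transform_div_sq (α : ℝ) (hα : -1 / 2 ≤ α) (μ : PMF ℕ)
    (hmom : Summable fun n : ℕ => (μ n).toReal * (n : ℝ) ^ 2) :
    Tendsto (fun θ : ℝ => (1 - transform α μ θ) / θ ^ 2) (nhdsWithin 0 {0}ᶜ)
      (nhds (diffConst α μ)) := by
  have hcos : Tendsto Real.cos (nhdsWithin 0 {0}ᶜ) (nhdsWithin 1 {1}ᶜ) := by
    refine tendsto_nhdsWithin_iff.2 ⟨?_, ?_⟩
    · simpa using (Real.continuous_cos.tendsto 0).mono_left nhdsWithin_le_nhds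
    · have hπ := Real.pi_pos
      filter_upwards [self_mem_nhdsWithin, nhdsWithin_le_nhds (Ioo_mem_nhds (neg_lt_zero.2 hπ) hπ)]
        with θ hθ hθ2 h
      exact hθ ((Real.cos_eq_one_iff_of_lt_of_lt (by linarith [hθ2.1]) (by linarith [hθ2.2])).1 h)
  set M : ℕ → ℝ := fun k => (k : ℝ) * ((k : ℝ) + 2 * α + 1) / (2 * (α + 1)) with hM
  have hsum : Summable fun k => (μ k).toReal * M k := by
    simp only [hM, mul_div_assoc']
    exact (summable_diffConst α hα μ hmom).div_const _
  have h1 : Tendsto (fun θ : ℝ => ∑' k, (μ k).toReal * ((1 - gegenbauerCos α k θ)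
      / (1 - Real.cos θ))) (nhdsWithin 0 {0}ᶜ) (nhds (∑' k, (μ k).toReal * M k)) := by
    refine tendsto_tsum_of_dominated_convergence hsum (fun k => ?_) ?_
    · refine Tendsto.const_mul _ ?_
      have hd := (hasDerivAt_iff_tendsto_slope.1 ((gegenbauer α k).hasDerivAt 1)).comp hcos
      rw [derivative_gegenbauer_eval_one α (by linarith)] at hd
      refine hd.congr fun θ => ?_
      rw [Function.comp, slope_def_field, gegenbauer_eval_one α (by linarith), gegenbauerCos,
        ← neg_div_neg_eq, neg_sub, neg_sub]
    · filter_upwards [self_mem_nhdsWithin, hcos self_mem_nhdsWithin] with θ hθ hθ1 k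
      have hc : 0 < 1 - Real.cos θ :=
        sub_pos.2 (lt_of_le_of_ne (Real.cos_le_one θ) hθ1)
      rw [norm_mul, Real.norm_of_nonneg ENNReal.toReal_nonneg]
      refine mul_le_mul_of_nonneg_left ?_ ENNReal.toReal_nonneg
      rw [norm_div, Real.norm_of_nonneg hc.le, div_le_iff₀ hc]
      exact abs_one_sub_gegenbauer_eval_le α hα k (Real.abs_cos_le_one θ)
  have h2 := h1.mul tendsto_one_sub_cos_div_sq
  have e : (∑' k, (μ k).toReal * M k) * (1 / 2) = diffConst α μ := by
    rw [diffConst, ← tsum_mul_left, ← tsum_mul_right]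
    congr 1
    funext k
    have : α + 1 ≠ 0 := by linarith
    simp only [hM]
    field_simp
    ring
  rw [e] at h2
  refine h2.congr' ?_
  filter_upwards [self_mem_nhdsWithin, hcos self_mem_nhdsWithin] with θ hθ hθ1
  have hc : 1 - Real.cos θ ≠ 0 := sub_ne_zero.2 (Ne.symm hθ1)
  have h3 := ((summable_toReal_pmf μ).hasSum.sub (hasSum_transform α hα μ θ)).div_const
    (1 - Real.cos θ)
  rw [tsum_toReal_pmf] at h3
  have h4 : ∑' k, (μ k).toReal * ((1 - gegenbauerCos α k θ) / (1 - Real.cos θ))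
      = (1 - transform α μ θ) / (1 - Real.cos θ) := by
    rw [← h3.tsum_eq]
    congr 1
    funext k
    ring
  rw [h4, div_mul_div_cancel₀ hc]

theorem exists_abs_transform_le_exp (α : ℝ) (hα : -1 / 2 ≤ α) (μ : PMF ℕ) (hμ : IsAperiodic α μ)
    (hmom : Summable fun n : ℕ => (μ n).toReal * (n : ℝ) ^ 2) :
    ∃ c : ℝ, 0 < c ∧ ∀ θ ∈ Set.Icc 0 Real.pi, |transform α μ θ| ≤ Real.exp (-c * θ ^ 2) := by
  have hC := diffConst_pos α hα μ hμ hmom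
  have hct := continuous_transform α hα μ
  have h1 := (tendsto_one_sub_transform_div_sq α hα μ hmom).eventually
    (lt_mem_nhds (half_lt_self hC))
  have h2 : ∀ᶠ θ in nhds (0 : ℝ), 0 < transform α μ θ := by
    refine (hct.tendsto 0).eventually (lt_mem_nhds ?_)
    rw [transform_zero α (by linarith)]
    exact one_pos
  obtain ⟨δ, hδ, hnear⟩ := Metric.eventually_nhds_iff.1
    ((eventually_nhdsWithin_iff.1 h1).and h2)
  set δ' := min δ Real.pi with hδ'
  have hδ'0 : 0 < δ' := lt_min hδ Real.pi_pos
  have hfar : ∃ m : ℝ, 0 < m ∧ ∀ θ ∈ Set.Icc δ' Real.pi, m ≤ 1 - |transform α μ θ| := by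
    obtain ⟨θ₀, hθ₀, hmin⟩ := isCompact_Icc.exists_isMinOn
      (Set.nonempty_Icc.2 (min_le_right δ Real.pi))
      (f := fun θ => 1 - |transform α μ θ|) (by fun_prop)
    exact ⟨_, sub_pos.2 (abs_transform_lt_one α hα μ hμ (hδ'0.trans_le hθ₀.1) hθ₀.2),
      fun θ hθ => hmin hθ⟩
  obtain ⟨m, hm, hfar⟩ := hfar
  have hπ := Real.pi_pos
  -- The first entry serves `θ < δ'`, where `1 - φ` exceeds `(C/2) θ²`; the second gives `c θ² ≤ m`
  -- on `[δ', π]`, where `1 - |φ| ≥ m` by compactness.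
  refine ⟨min (diffConst α μ / 2) (m / Real.pi ^ 2), lt_min (by positivity) (by positivity), ?_⟩
  set c := min (diffConst α μ / 2) (m / Real.pi ^ 2) with hc
  intro θ hθ
  suffices h : |transform α μ θ| ≤ 1 - c * θ ^ 2 by
    refine h.trans ?_
    have := Real.add_one_le_exp (-c * θ ^ 2)
    linarith
  rcases lt_or_ge θ δ' with hlt | hge
  · rcases eq_or_lt_of_le hθ.1 with rfl | hpos
    · rw [transform_zero α (by linarith)]
      simp
    · have hn := hnear (y := θ) (by
        rw [Real.dist_eq, sub_zero, abs_of_pos hpos]; exact hlt.trans_le (min_le_left _ _))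
      have h3 := hn.1 hpos.ne'
      rw [lt_div_iff₀ (by positivity)] at h3
      rw [abs_of_pos hn.2]
      have : c * θ ^ 2 ≤ diffConst α μ / 2 * θ ^ 2 :=
        mul_le_mul_of_nonneg_right (min_le_left _ _) (sq_nonneg θ)
      linarith
  · have h3 := hfar θ ⟨hge, hθ.2⟩
    have h4 : c * θ ^ 2 ≤ m := by
      calc c * θ ^ 2 ≤ m / Real.pi ^ 2 * Real.pi ^ 2 :=
            mul_le_mul (min_le_right _ _) (pow_le_pow_left₀ hθ.1 hθ.2 2) (sq_nonneg _)
              (by positivity)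
        _ = m := by field_simp
    linarith

theorem tendsto_div_sqrt_natCast (s : ℝ) :
    Tendsto (fun n : ℕ => s / √(n : ℝ)) atTop (nhds 0) :=
  tendsto_const_nhds.div_atTop (Real.tendsto_sqrt_atTop.comp tendsto_natCast_atTop_atTop)

theorem tendsto_transform_pow (α : ℝ) (hα : -1 / 2 ≤ α) (μ : PMF ℕ)
    (hmom : Summable fun n : ℕ => (μ n).toReal * (n : ℝ) ^ 2) {s : ℝ} (hs : 0 < s) :
    Tendsto (fun n : ℕ => transform α μ (s / √(n : ℝ)) ^ n) atTop
      (nhds (Real.exp (-diffConst α μ * s ^ 2))) := by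
  have h0 : Tendsto (fun n : ℕ => s / √(n : ℝ)) atTop (nhdsWithin 0 {0}ᶜ) := by
    refine tendsto_nhdsWithin_iff.2 ⟨tendsto_div_sqrt_natCast s, ?_⟩
    filter_upwards [eventually_gt_atTop 0] with n hn
    have : (0 : ℝ) < n := by exact_mod_cast hn
    exact (div_pos hs (Real.sqrt_pos.2 this)).ne'
  have h1 := ((tendsto_one_sub_transform_div_sq α hα μ hmom).comp h0).const_mul (-s ^ 2)
  have h2 : Tendsto (fun n : ℕ => (n : ℝ) * (transform α μ (s / √(n : ℝ)) - 1)) atTop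
      (nhds (-diffConst α μ * s ^ 2)) := by
    rw [show -diffConst α μ * s ^ 2 = -s ^ 2 * diffConst α μ by ring]
    refine h1.congr' ?_
    filter_upwards [eventually_gt_atTop 0] with n hn
    have hn' : (0 : ℝ) < n := by exact_mod_cast hn
    rw [Function.comp, div_pow, Real.sq_sqrt hn'.le]
    field_simp
    ring
  refine (Real.tendsto_one_add_pow_exp_of_tendsto h2).congr fun n => ?_
  rw [add_sub_cancel]

/-! ### The normalized Bessel function and the Mehler–Heine limit. -/

/-- The rising factorial `a (a + 1) ⋯ (a + k - 1)`. -/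
noncomputable def rising (a : ℝ) (k : ℕ) : ℝ := ∏ i ∈ Finset.range k, (a + i)

theorem rising_pos {a : ℝ} (ha : 0 < a) (k : ℕ) : 0 < rising a k :=
  Finset.prod_pos fun i _ => by positivity

theorem rising_add (a : ℝ) (i j : ℕ) : rising a (i + j) = rising a i * rising (a + i) j := by
  simp only [rising, Finset.prod_range_add, Nat.cast_add, add_assoc]

theorem rising_succ' (a : ℝ) (k : ℕ) : rising a (k + 1) = a * rising (a + 1) k := by
  rw [add_comm k 1, rising_add]
  simp [rising]

/-- Lets the exponential series dominate `normBessel`, which is used at `a = α + 1 ≥ 1/2`. -/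
theorem half_le_rising {a : ℝ} (ha : 1 / 2 ≤ a) (k : ℕ) : 1 / 2 ≤ rising a k := by
  cases k with
  | zero => norm_num [rising]
  | succ k =>
    rw [rising_succ']
    have h1 : 1 ≤ rising (a + 1) k := by
      refine Finset.prod_induction _ (fun x : ℝ => 1 ≤ x) (fun x y hx hy => ?_) le_rfl
        fun i _ => ?_
      · nlinarith
      · have : (0 : ℝ) ≤ i := i.cast_nonneg
        linarith
    nlinarith

theorem Gamma_add_natCast {a : ℝ} (ha : 0 < a) (k : ℕ) :
    Real.Gamma (a + k) = Real.Gamma a * rising a k := by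
  induction k with
  | zero => simp [rising]
  | succ k ih =>
    have : a + (k : ℝ) ≠ 0 := by positivity
    rw [Nat.cast_succ, ← add_assoc, Real.Gamma_add_one this, ih, rising, rising,
      Finset.prod_range_succ]
    ring

/-- The normalized Bessel function: `normBessel a z = ∑ z^k / (k! (a)_k)`. -/
noncomputable def normBessel (a z : ℝ) : ℝ :=
  ∑' k : ℕ, z ^ k / ((k.factorial : ℝ) * rising a k)

theorem summable_norm_normBessel {a : ℝ} (ha : 1 / 2 ≤ a) (z : ℝ) :
    Summable fun k : ℕ => ‖z ^ k / ((k.factorial : ℝ) * rising a k)‖ := by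
  refine Summable.of_nonneg_of_le (fun k => norm_nonneg _) (fun k => ?_)
    ((Real.summable_pow_div_factorial |z|).mul_left 2)
  have hr := half_le_rising ha k
  have hf : (0 : ℝ) < k.factorial := by exact_mod_cast k.factorial_pos
  rw [norm_div, norm_pow, Real.norm_eq_abs, Real.norm_of_nonneg (mul_nonneg hf.le (by linarith)),
    div_le_iff₀ (mul_pos hf (by linarith)), mul_div_assoc', div_mul_eq_mul_div, le_div_iff₀ hf]
  have : 0 ≤ |z| ^ k * k.factorial := by positivity
  nlinarith

/-- For `k > n` the factor `i = n` is zero, so the Taylor sum extends to a full series, and the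
degree may vary under dominated convergence. -/
theorem gegenbauerCos_eq_tsum (α : ℝ) (hα : -1 < α) (n : ℕ) (θ : ℝ) :
    gegenbauerCos α n θ = ∑' k : ℕ, (∏ i ∈ Finset.range k, ((n : ℝ) - i)
      * ((n : ℝ) + 2 * α + 1 + i) * (Real.cos θ - 1) / (2 * (α + 1 + i))) / (k.factorial : ℝ) := by
  rw [tsum_eq_sum (s := Finset.range (n + 1)), gegenbauerCos, gegenbauer_eval_eq_sum α hα]
  · refine Finset.sum_congr rfl fun k _ => ?_
    simp only [mul_div_right_comm _ (Real.cos θ - 1), Finset.prod_mul_distrib, Finset.prod_const,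
      Finset.card_range]
    ring
  · intro k hk
    rw [Finset.prod_eq_zero (i := n), zero_div]
    · simp at hk ⊢; omega
    · simp

/-- Mehler–Heine asymptotics. -/
theorem tendsto_gegenbauerCos (α : ℝ) (hα : -1 / 2 ≤ α) {N : ℕ → ℕ} {v : ℝ}
    (hN : Tendsto (fun n : ℕ => (N n : ℝ) / √(n : ℝ)) atTop (nhds v)) {s : ℝ} (hs : 0 < s) :
    Tendsto (fun n : ℕ => gegenbauerCos α (N n) (s / √(n : ℝ))) atTop
      (nhds (normBessel (α + 1) (-(v * s) ^ 2 / 4))) := by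
  have hsq : Tendsto (fun n : ℕ => √(n : ℝ)) atTop atTop :=
    Real.tendsto_sqrt_atTop.comp tendsto_natCast_atTop_atTop
  have h0 : Tendsto (fun n : ℕ => s / √(n : ℝ)) atTop (nhdsWithin 0 {0}ᶜ) := by
    refine tendsto_nhdsWithin_iff.2 ⟨tendsto_div_sqrt_natCast s, ?_⟩
    filter_upwards [eventually_gt_atTop 0] with n hn
    have : (0 : ℝ) < n := by exact_mod_cast hn
    exact (div_pos hs (Real.sqrt_pos.2 this)).ne'
  have hc : Tendsto (fun n : ℕ => (1 - Real.cos (s / √(n : ℝ))) * (n : ℝ)) atTop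
      (nhds (s ^ 2 / 2)) := by
    have h1 := (tendsto_one_sub_cos_div_sq.comp h0).const_mul (s ^ 2)
    rw [mul_one_div] at h1
    refine h1.congr' ?_
    filter_upwards [eventually_gt_atTop 0] with n hn
    have hn' : (0 : ℝ) < n := by exact_mod_cast hn
    rw [Function.comp, div_pow, Real.sq_sqrt hn'.le]
    field_simp
  have hshift : ∀ b : ℝ, Tendsto (fun n : ℕ => ((N n : ℝ) + b) / √(n : ℝ)) atTop (nhds v) := by
    intro b
    have := hN.add ((tendsto_const_nhds (x := b)).div_atTop hsq)
    rw [add_zero] at this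
    exact this.congr fun n => (add_div _ _ _).symm
  -- With `d = 1` these are the factors of the `k`-th term. With `d = 2`, `b = 0`, `c = 2α + 1` the
  -- expression dominates each of them for `i ≤ N`, since `N + i ≤ 2N` and `2(α + 1 + i) ≥ 1`; this
  -- produces `K`.
  have hfac : ∀ b c d : ℝ, Tendsto (fun n : ℕ => ((N n : ℝ) + b) * (d * (N n : ℝ) + c)
      * (1 - Real.cos (s / √(n : ℝ)))) atTop (nhds (v * (d * v) * (s ^ 2 / 2))) := by
    intro b c d
    have hd : Tendsto (fun n : ℕ => (d * (N n : ℝ) + c) / √(n : ℝ)) atTop (nhds (d * v)) := by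
      have := (hN.const_mul d).add ((tendsto_const_nhds (x := c)).div_atTop hsq)
      rw [add_zero] at this
      exact this.congr fun n => by ring
    refine (((hshift b).mul hd).mul hc).congr' ?_
    filter_upwards [eventually_gt_atTop 0] with n hn
    have hn' : (0 : ℝ) < n := by exact_mod_cast hn
    have e : (n : ℝ) = √(n : ℝ) * √(n : ℝ) := (Real.mul_self_sqrt hn'.le).symm
    have e2 : ((N n : ℝ) + b) / √(n : ℝ) * ((d * (N n : ℝ) + c) / √(n : ℝ)) * (n : ℝ)
        = ((N n : ℝ) + b) * (d * (N n : ℝ) + c) := by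
      rw [div_mul_div_comm, ← e, div_mul_cancel₀ _ hn'.ne']
    linear_combination (1 - Real.cos (s / √(n : ℝ))) * e2
  simp only [gegenbauerCos_eq_tsum α (by linarith : -1 < α), normBessel]
  obtain ⟨K, hK⟩ : ∃ K : ℝ, v * (2 * v) * (s ^ 2 / 2) < K := exists_gt _
  have hK' := (hfac 0 (2 * α + 1) 2).eventually (gt_mem_nhds hK)
  refine tendsto_tsum_of_dominated_convergence (Real.summable_pow_div_factorial K) (fun k => ?_) ?_
  · rw [show (-(v * s) ^ 2 / 4) ^ k / ((k.factorial : ℝ) * rising (α + 1) k)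
      = (∏ i ∈ Finset.range k, (-(v * s) ^ 2 / 4 / (α + 1 + i))) / (k.factorial : ℝ) by
        rw [Finset.prod_div_distrib, Finset.prod_const, Finset.card_range, rising, div_div,
          mul_comm (∏ i ∈ _, _)]]
    refine Tendsto.div_const (tendsto_finsetProd _ fun i _ => ?_) _
    have hi : (0 : ℝ) ≤ i := i.cast_nonneg
    have h1 := (hfac (-i) (2 * α + 1 + i) 1).div_const (-(2 * (α + 1 + i)))
    have e : v * (1 * v) * (s ^ 2 / 2) / (-(2 * (α + 1 + i))) = -(v * s) ^ 2 / 4 / (α + 1 + i) := by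
      rw [div_neg]
      have : α + 1 + i ≠ 0 := by linarith
      field_simp
      ring
    rw [e] at h1
    refine h1.congr fun n => ?_
    rw [div_neg, ← neg_div]
    congr 1
    ring
  · filter_upwards [hK'] with n hn k
    have hf : (0 : ℝ) < k.factorial := by exact_mod_cast k.factorial_pos
    rw [norm_div, Real.norm_of_nonneg hf.le]
    refine div_le_div_of_nonneg_right ?_ hf.le
    rcases Nat.lt_or_ge (N n) k with hlt | hge
    · rw [Finset.prod_eq_zero (Finset.mem_range.2 hlt) (by simp), norm_zero]
      have : 0 ≤ K := le_trans (by nlinarith [sq_nonneg (v * s)]) hK.le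
      positivity
    · rw [norm_prod]
      calc _ ≤ ∏ i ∈ Finset.range k, K := by
            refine Finset.prod_le_prod (fun i _ => norm_nonneg _) fun i hi => le_trans ?_ hn.le
            have hi0 : (0 : ℝ) ≤ i := i.cast_nonneg
            have hiN : (i : ℝ) ≤ N n := by
              exact_mod_cast ((Finset.mem_range.1 hi).trans_le hge).le
            have hcos : 0 ≤ 1 - Real.cos (s / √(n : ℝ)) := sub_nonneg.2 (Real.cos_le_one _)
            have e : ((N n : ℝ) - i) * ((N n : ℝ) + 2 * α + 1 + i) *
                (Real.cos (s / √(n : ℝ)) - 1) / (2 * (α + 1 + i))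
                = -(((N n : ℝ) - i) * ((N n : ℝ) + 2 * α + 1 + i) *
                (1 - Real.cos (s / √(n : ℝ))) / (2 * (α + 1 + i))) := by ring
            have hA : 0 ≤ ((N n : ℝ) - i) * ((N n : ℝ) + 2 * α + 1 + i) :=
              mul_nonneg (by linarith) (by linarith)
            rw [e, norm_neg, Real.norm_of_nonneg
              (div_nonneg (mul_nonneg hA hcos) (by linarith))]
            refine (div_le_self (mul_nonneg hA hcos) (by linarith)).trans ?_
            refine mul_le_mul_of_nonneg_right ?_ hcos
            exact mul_le_mul (by linarith) (by linarith) (by linarith) (by linarith)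
        _ = K ^ k := by simp

/-! ### Weber's second exponential integral. -/

/-- The Chu–Vandermonde identity for rising factorials. -/
theorem rising_add_natCast (n : ℕ) (j : ℕ) : ∀ a : ℝ,
    rising (a + n) j = ∑ k ∈ Finset.range (j + 1),
      (j.choose k : ℝ) * ((n.descFactorial k : ℝ) * rising (a + k) (j - k)) := by
  induction j with
  | zero => intro a; simp [rising]
  | succ j ih =>
    intro a
    rw [Finset.sum_choose_succ_mul (fun k l => (n.descFactorial k : ℝ) * rising (a + k) l),
      ← Finset.sum_add_distrib, rising_succ', show a + (n : ℝ) + 1 = (a + 1) + n by ring,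
      ih (a + 1), Finset.mul_sum]
    refine Finset.sum_congr rfl fun k hk => ?_
    have hk' : k ≤ j := Nat.lt_succ_iff.1 (Finset.mem_range.1 hk)
    have e1 : j + 1 - k = (j - k) + 1 := by omega
    have e2 : (n.descFactorial (k + 1) : ℝ) = ((n : ℝ) - k) * n.descFactorial k := by
      rw [Nat.descFactorial_succ]
      rcases Nat.lt_or_ge n k with h | h
      · simp [Nat.descFactorial_of_lt h]
      · push_cast [h]; ring
    rw [e1, rising_succ', e2, Nat.cast_succ, show a + ((k : ℝ) + 1) = a + k + 1 by ring,
      show a + 1 + (k : ℝ) = a + k + 1 by ring]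
    ring

/-- With `i = k + p` and `j = k + q`, a Chu–Vandermonde summand splits into a term of `normBessel a
(z * w)` and terms of `exp z` and `exp w`. -/
theorem weber_term {a : ℝ} (ha : 0 < a) (z w : ℝ) (k p q : ℕ) :
    z ^ (k + p) * w ^ (k + q) * (((k + q).choose k : ℝ)
        * (((k + p).descFactorial k : ℝ) * rising (a + k) (k + q - k)))
        / (((k + p).factorial : ℝ) * (((k + q).factorial : ℝ) * rising a (k + q)))
      = (z * w) ^ k / ((k.factorial : ℝ) * rising a k)
        * (z ^ p / (p.factorial : ℝ) * (w ^ q / (q.factorial : ℝ))) := by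
  have d := Nat.factorial_mul_descFactorial (Nat.le_add_right k p)
  have c := Nat.add_choose_mul_factorial_mul_factorial k q
  rw [Nat.add_sub_cancel_left] at d
  rw [← Nat.choose_symm_add] at c
  have d' : (p.factorial : ℝ) * ((k + p).descFactorial k : ℝ) = ((k + p).factorial : ℝ) := by
    exact_mod_cast d
  have c' : ((k + q).choose k : ℝ) * k.factorial * q.factorial = ((k + q).factorial : ℝ) := by
    exact_mod_cast c
  have r1 := (rising_pos ha k).ne'
  have r2 := (rising_pos (by positivity : 0 < a + k) q).ne'
  have f1 : (p.factorial : ℝ) ≠ 0 := by exact_mod_cast p.factorial_ne_zero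
  have f2 : (k.factorial : ℝ) ≠ 0 := by exact_mod_cast k.factorial_ne_zero
  have f3 : (q.factorial : ℝ) ≠ 0 := by exact_mod_cast q.factorial_ne_zero
  have f4 : ((k + p).factorial : ℝ) ≠ 0 := by exact_mod_cast (k + p).factorial_ne_zero
  have f5 : ((k + q).factorial : ℝ) ≠ 0 := by exact_mod_cast (k + q).factorial_ne_zero
  rw [Nat.add_sub_cancel_left, rising_add, div_mul_div_comm, div_mul_div_comm,
    div_eq_div_iff (mul_ne_zero f4 (mul_ne_zero f5 (mul_ne_zero r1 r2)))
      (mul_ne_zero (mul_ne_zero f2 r1) (mul_ne_zero f1 f3)), ← d', ← c']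
  ring

theorem rising_add_div {a : ℝ} (ha : 0 < a) (z w : ℝ) (i j : ℕ) :
    z ^ i * w ^ j * rising a (i + j)
        / ((i.factorial : ℝ) * rising a i * ((j.factorial : ℝ) * rising a j))
      = z ^ i * w ^ j * rising (a + i) j
        / ((i.factorial : ℝ) * ((j.factorial : ℝ) * rising a j)) := by
  have hi : rising a i ≠ 0 := (rising_pos ha i).ne'
  rw [rising_add, mul_left_comm, mul_comm (i.factorial : ℝ), mul_assoc (rising a i),
    mul_div_mul_left _ _ hi]

/-- The double series behind Weber's second exponential integral. -/
theorem hasSum_weber {a : ℝ} (ha : 1 / 2 ≤ a) (z w : ℝ) :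
    HasSum (fun p : ℕ × ℕ => z ^ p.1 * w ^ p.2 * rising a (p.1 + p.2)
        / ((p.1.factorial : ℝ) * rising a p.1 * ((p.2.factorial : ℝ) * rising a p.2)))
      (Real.exp (z + w) * normBessel a (z * w)) := by
  have ha0 : 0 < a := by linarith
  have hz : HasSum (fun p : ℕ => z ^ p / (p.factorial : ℝ)) (Real.exp z) := by
    rw [Real.exp_eq_exp_ℝ]; exact NormedSpace.expSeries_div_hasSum_exp z
  have hw : HasSum (fun p : ℕ => w ^ p / (p.factorial : ℝ)) (Real.exp w) := by
    rw [Real.exp_eq_exp_ℝ]; exact NormedSpace.expSeries_div_hasSum_exp w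
  have hb : HasSum (fun k : ℕ => (z * w) ^ k / ((k.factorial : ℝ) * rising a k))
      (normBessel a (z * w)) := (summable_norm_normBessel ha (z * w)).of_norm.hasSum
  have s1 := summable_mul_of_summable_norm hz.summable.norm hw.summable.norm
  have h1 := hz.mul hw s1
  have h2 := hb.mul h1 (summable_mul_of_summable_norm hb.summable.norm s1.norm)
  -- The triple series obtained by expanding `rising (a + i) j`. It vanishes unless `k ≤ i` and `k ≤
  -- j`, that is, off the range of `e`; along `e` it is the product series, and summing over `k`
  -- recovers the double series.
  set F : (ℕ × ℕ) × ℕ → ℝ := fun q => z ^ q.1.1 * w ^ q.1.2 * ((q.1.2.choose q.2 : ℝ)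
    * ((q.1.1.descFactorial q.2 : ℝ) * rising (a + q.2) (q.1.2 - q.2)))
    / ((q.1.1.factorial : ℝ) * ((q.1.2.factorial : ℝ) * rising a q.1.2)) with hF
  set e : ℕ × ℕ × ℕ → (ℕ × ℕ) × ℕ := fun q => ((q.1 + q.2.1, q.1 + q.2.2), q.1) with he
  have hinj : Function.Injective e := by
    rintro ⟨k, p, q⟩ ⟨k', p', q'⟩ h
    simp only [he, Prod.mk.injEq] at h ⊢
    omega
  have h3 : HasSum F (normBessel a (z * w) * (Real.exp z * Real.exp w)) := by
    refine (hinj.hasSum_iff ?_).1 ?_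
    · rintro ⟨⟨i, j⟩, k⟩ hq
      rcases Nat.lt_or_ge i k with h | h
      · simp [hF, Nat.descFactorial_of_lt h]
      rcases Nat.lt_or_ge j k with h' | h'
      · simp [hF, Nat.choose_eq_zero_of_lt h']
      refine absurd ⟨(k, i - k, j - k), ?_⟩ hq
      change ((k + (i - k), k + (j - k)), k) = ((i, j), k)
      rw [Nat.add_sub_cancel' h, Nat.add_sub_cancel' h']
    · refine h2.congr_fun fun q => ?_
      exact weber_term ha0 z w q.1 q.2.1 q.2.2
  have h4 := h3.prod_fiberwise (g := fun p : ℕ × ℕ => z ^ p.1 * w ^ p.2 * rising a (p.1 + p.2)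
        / ((p.1.factorial : ℝ) * rising a p.1 * ((p.2.factorial : ℝ) * rising a p.2))) ?_
  · rwa [Real.exp_add, mul_comm]
  · rintro ⟨i, j⟩
    have h5 : HasSum (fun k => F ((i, j), k)) (∑ k ∈ Finset.range (j + 1), F ((i, j), k)) := by
      refine hasSum_sum_of_ne_finset_zero fun k hk => ?_
      have : j < k := by simp at hk; omega
      simp [hF, Nat.choose_eq_zero_of_lt this]
    have h6 : ∑ k ∈ Finset.range (j + 1), F ((i, j), k) = z ^ i * w ^ j * rising (a + i) j
        / ((i.factorial : ℝ) * ((j.factorial : ℝ) * rising a j)) := by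
      rw [rising_add_natCast, Finset.mul_sum, Finset.sum_div]
    rw [h6, ← rising_add_div ha0] at h5
    exact h5

theorem integral_rpow_mul_exp_neg_mul_sq_eq {a C : ℝ} (ha : 0 < a) (hC : 0 < C) (m : ℕ) :
    ∫ s in Set.Ioi (0 : ℝ), s ^ (2 * (m : ℝ) + 2 * a - 1) * Real.exp (-C * s ^ 2)
      = Real.Gamma a / (2 * C ^ a) * (rising a m / C ^ m) := by
  have hm : (0 : ℝ) ≤ m := m.cast_nonneg
  have h := integral_rpow_mul_exp_neg_mul_rpow (p := 2) (q := 2 * (m : ℝ) + 2 * a - 1) two_pos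
    (by linarith) hC
  simp only [Real.rpow_two] at h
  rw [h, show (2 * (m : ℝ) + 2 * a - 1 + 1) / 2 = a + m by ring,
    show -(2 * (m : ℝ) + 2 * a - 1 + 1) / 2 = -(a + m) by ring, Gamma_add_natCast ha,
    Real.rpow_neg hC.le, Real.rpow_add hC, Real.rpow_natCast]
  have := Real.rpow_pos_of_pos hC a
  field_simp

/-- Weber's second exponential integral. -/
theorem integral_weber {a C : ℝ} (ha : 1 / 2 ≤ a) (hC : 0 < C) (u v : ℝ) :
    ∫ s in Set.Ioi (0 : ℝ), Real.exp (-C * s ^ 2) * normBessel a (-(u * s) ^ 2 / 4)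
        * normBessel a (-(v * s) ^ 2 / 4) * s ^ (2 * a - 1)
      = Real.Gamma a / (2 * C ^ a) * (Real.exp (-(u ^ 2 + v ^ 2) / (4 * C))
        * normBessel a ((u * v / (4 * C)) ^ 2)) := by
  have ha0 : 0 < a := by linarith
  set c : ℝ → ℝ → ℕ × ℕ → ℝ := fun z w p => z ^ p.1 * w ^ p.2
    / ((p.1.factorial : ℝ) * rising a p.1 * ((p.2.factorial : ℝ) * rising a p.2)) with hc
  set E : ℕ × ℕ → ℝ → ℝ := fun p s =>
    s ^ (2 * ((p.1 + p.2 : ℕ) : ℝ) + 2 * a - 1) * Real.exp (-C * s ^ 2) with hE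
  have hEint : ∀ p, MeasureTheory.IntegrableOn (E p) (Set.Ioi 0) := fun p =>
    integrableOn_rpow_mul_exp_neg_mul_sq hC (by
      have : (0 : ℝ) ≤ ((p.1 + p.2 : ℕ) : ℝ) := Nat.cast_nonneg _
      linarith)
  have hsum : ∀ z w : ℝ, HasSum (fun p => c z w p * ∫ s in Set.Ioi (0 : ℝ), E p s)
      (Real.Gamma a / (2 * C ^ a) * (Real.exp (z / C + w / C) * normBessel a (z / C * (w / C)))) := by
    intro z w
    refine ((hasSum_weber ha (z / C) (w / C)).mul_left (Real.Gamma a / (2 * C ^ a))).congr_fun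
      fun p => ?_
    rw [integral_rpow_mul_exp_neg_mul_sq_eq ha0 hC, hc]
    simp only [div_pow, pow_add]
    field_simp
  -- Taking absolute values only removes the signs of `-u²/4` and `-v²/4`, so `hsum` itself gives
  -- the absolute convergence needed to exchange sum and integral.
  have hnorm : ∀ p, ∫ s in Set.Ioi (0 : ℝ), ‖c (-u ^ 2 / 4) (-v ^ 2 / 4) p * E p s‖
      = c (u ^ 2 / 4) (v ^ 2 / 4) p * ∫ s in Set.Ioi (0 : ℝ), E p s := by
    intro p
    rw [← MeasureTheory.integral_const_mul]
    refine MeasureTheory.setIntegral_congr_fun measurableSet_Ioi fun s hs => ?_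
    have hE0 : 0 ≤ E p s := mul_nonneg (Real.rpow_nonneg (le_of_lt hs) _) (Real.exp_pos _).le
    have r1 := rising_pos ha0 p.1
    have r2 := rising_pos ha0 p.2
    simp only [norm_mul, Real.norm_of_nonneg hE0]
    congr 1
    simp only [hc, norm_div, norm_mul, norm_pow, norm_neg, Real.norm_eq_abs]
    rw [abs_of_pos r1, abs_of_pos r2]
    simp
  have h1 := MeasureTheory.hasSum_integral_of_summable_integral_norm
    (μ := MeasureTheory.volume.restrict (Set.Ioi 0))
    (F := fun p s => c (-u ^ 2 / 4) (-v ^ 2 / 4) p * E p s)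
    (fun p => (hEint p).const_mul _) (by simp only [hnorm]; exact (hsum _ _).summable)
  simp only [MeasureTheory.integral_const_mul] at h1
  have h2 := h1.unique (hsum (-u ^ 2 / 4) (-v ^ 2 / 4))
  rw [show (u * v / (4 * C)) ^ 2 = -u ^ 2 / 4 / C * (-v ^ 2 / 4 / C) by field_simp,
    show -(u ^ 2 + v ^ 2) / (4 * C) = -u ^ 2 / 4 / C + -v ^ 2 / 4 / C by field_simp; ring, ← h2]
  refine MeasureTheory.setIntegral_congr_fun measurableSet_Ioi fun s hs => ?_
  have hs' : (0 : ℝ) < s := hs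
  rw [mul_assoc (Real.exp _), normBessel, normBessel,
    tsum_mul_tsum_of_summable_norm (summable_norm_normBessel ha _) (summable_norm_normBessel ha _),
    ← tsum_mul_left, ← tsum_mul_right]
  congr 1
  funext p
  simp only [hc, hE]
  rw [show 2 * ((p.1 + p.2 : ℕ) : ℝ) + 2 * a - 1 = (2 * a - 1) + ((2 * (p.1 + p.2) : ℕ) : ℝ) by
    push_cast; ring, Real.rpow_add hs', Real.rpow_natCast, mul_add, pow_add, pow_mul, pow_mul,
    show -(u * s) ^ 2 / 4 = -u ^ 2 / 4 * s ^ 2 by ring,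
    show -(v * s) ^ 2 / 4 = -v ^ 2 / 4 * s ^ 2 by ring, mul_pow, mul_pow (-v ^ 2 / 4)]
  ring

/-! ### Rescaling and passage to the limit. -/

/-- The integrand of the spectral representation after the rescaling `θ = s / √n`. -/
noncomputable def rescaledIntegrand (α : ℝ) (μ : PMF ℕ) (n x y : ℕ) (s : ℝ) : ℝ :=
  (Set.Ioc 0 (Real.pi * √(n : ℝ))).indicator (fun s => transform α μ (s / √(n : ℝ)) ^ n
    * gegenbauerCos α x (s / √(n : ℝ)) * gegenbauerCos α y (s / √(n : ℝ))
    * (√(n : ℝ) * Real.sin (s / √(n : ℝ))) ^ (2 * α + 1)) s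

/-- The factor `√n` compensates `dθ = ds/√n`, and the powers `2α + 1` of `√n` and `y` are
distributed so that each of the three factors converges. -/
theorem sqrt_mul_nStep_eq (α : ℝ) (hα : -1 / 2 ≤ α) (μ : PMF ℕ) {n : ℕ} (hn : 0 < n) (x : ℕ)
    {y : ℕ} (hy : 0 < y) :
    √(n : ℝ) * nStep α hα μ n x y = (sqNorm α y)⁻¹ / (y : ℝ) ^ (2 * α + 1)
      * ((y : ℝ) / √(n : ℝ)) ^ (2 * α + 1)
      * ∫ s in Set.Ioi (0 : ℝ), rescaledIntegrand α μ n x y s := by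
  have hr : 0 < √(n : ℝ) := Real.sqrt_pos.2 (by exact_mod_cast hn)
  have hy' : (0 : ℝ) < y := by exact_mod_cast hy
  have hπ := Real.pi_pos
  have h1 : ∫ s in Set.Ioi (0 : ℝ), rescaledIntegrand α μ n x y s
      = ∫ s in (0 : ℝ)..(Real.pi * √(n : ℝ)), transform α μ (s / √(n : ℝ)) ^ n
        * gegenbauerCos α x (s / √(n : ℝ)) * gegenbauerCos α y (s / √(n : ℝ))
        * (√(n : ℝ) * Real.sin (s / √(n : ℝ))) ^ (2 * α + 1) := by
    rw [intervalIntegral.integral_of_le (by positivity)]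
    simp only [rescaledIntegrand]
    rw [MeasureTheory.setIntegral_indicator measurableSet_Ioc,
      Set.inter_eq_self_of_subset_right Set.Ioc_subset_Ioi_self]
  have h2 := intervalIntegral.integral_comp_div (a := 0) (b := Real.pi * √(n : ℝ))
    (fun θ => transform α μ θ ^ n * gegenbauerCos α x θ * gegenbauerCos α y θ
      * (√(n : ℝ) * Real.sin θ) ^ (2 * α + 1)) hr.ne'
  rw [zero_div, mul_div_cancel_right₀ _ hr.ne'] at h2
  have h3 : (∫ θ in (0 : ℝ)..Real.pi, transform α μ θ ^ n * gegenbauerCos α x θ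
      * gegenbauerCos α y θ * (√(n : ℝ) * Real.sin θ) ^ (2 * α + 1))
      = √(n : ℝ) ^ (2 * α + 1) * weightedIntegral α
      (fun θ => transform α μ θ ^ n * gegenbauerCos α x θ * gegenbauerCos α y θ) := by
    rw [weightedIntegral, ← intervalIntegral.integral_const_mul]
    refine intervalIntegral.integral_congr fun θ hθ => ?_
    rw [Set.uIcc_of_le hπ.le] at hθ
    rw [Real.mul_rpow hr.le (Real.sin_nonneg_of_nonneg_of_le_pi hθ.1 hθ.2)]
    ring
  rw [h1, h2, h3, nStep_eq, smul_eq_mul, Real.div_rpow hy'.le hr.le]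
  have p1 := (Real.rpow_pos_of_pos hr (2 * α + 1)).ne'
  have p2 := (Real.rpow_pos_of_pos hy' (2 * α + 1)).ne'
  field_simp

theorem tendsto_rescaledIntegrand (α : ℝ) (hα : -1 / 2 ≤ α) (μ : PMF ℕ)
    (hmom : Summable fun n : ℕ => (μ n).toReal * (n : ℝ) ^ 2) {M N : ℕ → ℕ} {u v : ℝ}
    (hM : Tendsto (fun n : ℕ => (M n : ℝ) / √(n : ℝ)) atTop (nhds u))
    (hN : Tendsto (fun n : ℕ => (N n : ℝ) / √(n : ℝ)) atTop (nhds v)) {s : ℝ} (hs : 0 < s) :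
    Tendsto (fun n => rescaledIntegrand α μ n (M n) (N n) s) atTop
      (nhds (Real.exp (-diffConst α μ * s ^ 2) * normBessel (α + 1) (-(u * s) ^ 2 / 4)
        * normBessel (α + 1) (-(v * s) ^ 2 / 4) * s ^ (2 * α + 1))) := by
  have hsq : Tendsto (fun n : ℕ => √(n : ℝ)) atTop atTop :=
    Real.tendsto_sqrt_atTop.comp tendsto_natCast_atTop_atTop
  have hsin : Tendsto (fun n : ℕ => √(n : ℝ) * Real.sin (s / √(n : ℝ))) atTop (nhds s) := by
    have h1 := ((Real.continuous_sinc.tendsto 0).comp (tendsto_div_sqrt_natCast s)).const_mul s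
    rw [Real.sinc_zero, mul_one] at h1
    refine h1.congr' ?_
    filter_upwards [eventually_gt_atTop 0] with n hn
    have hr : 0 < √(n : ℝ) := Real.sqrt_pos.2 (by exact_mod_cast hn)
    rw [Function.comp, Real.sinc_of_ne_zero (div_pos hs hr).ne']
    field_simp
  have h1 := (((tendsto_transform_pow α hα μ hmom hs).mul (tendsto_gegenbauerCos α hα hM hs)).mul
    (tendsto_gegenbauerCos α hα hN hs)).mul (hsin.rpow_const (p := 2 * α + 1) (Or.inl hs.ne'))
  refine h1.congr' ?_
  filter_upwards [hsq.eventually_ge_atTop (s / Real.pi)] with n hn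
  rw [rescaledIntegrand, Set.indicator_of_mem]
  exact ⟨hs, by rwa [div_le_iff₀' Real.pi_pos] at hn⟩

/-- Uniform in `n`, `x`, `y`: `exp(-cθ²)^n = exp(-cs²)` at `θ = s/√n`, `|P| ≤ 1`, and `√n sin(s/√n)
≤ s`. -/
theorem norm_rescaledIntegrand_le (α : ℝ) (hα : -1 / 2 ≤ α) (μ : PMF ℕ) {c : ℝ}
    (hc : ∀ θ ∈ Set.Icc 0 Real.pi, |transform α μ θ| ≤ Real.exp (-c * θ ^ 2)) (n x y : ℕ) {s : ℝ}
    (hs : 0 < s) :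
    ‖rescaledIntegrand α μ n x y s‖ ≤ s ^ (2 * α + 1) * Real.exp (-c * s ^ 2) := by
  have hbound : 0 ≤ s ^ (2 * α + 1) * Real.exp (-c * s ^ 2) := by positivity
  by_cases hmem : s ∈ Set.Ioc 0 (Real.pi * √(n : ℝ))
  · rw [rescaledIntegrand, Set.indicator_of_mem hmem]
    have hr : 0 < √(n : ℝ) := by
      refine pos_of_mul_pos_right (a := Real.pi) (hs.trans_le hmem.2) Real.pi_pos.le
    have hn : (0 : ℝ) < n := Real.sqrt_pos.1 hr
    have hθ : s / √(n : ℝ) ∈ Set.Icc 0 Real.pi := ⟨by positivity, by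
      rw [div_le_iff₀ hr]; exact hmem.2⟩
    have hsin0 := Real.sin_nonneg_of_nonneg_of_le_pi hθ.1 hθ.2
    have h1 : |transform α μ (s / √(n : ℝ)) ^ n| ≤ Real.exp (-c * s ^ 2) := by
      rw [abs_pow]
      refine (pow_le_pow_left₀ (abs_nonneg _) (hc _ hθ) n).trans (le_of_eq ?_)
      rw [← Real.exp_nat_mul, div_pow, Real.sq_sqrt hn.le]
      congr 1
      field_simp
    have h2 : |(√(n : ℝ) * Real.sin (s / √(n : ℝ))) ^ (2 * α + 1)| ≤ s ^ (2 * α + 1) := by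
      rw [abs_of_nonneg (Real.rpow_nonneg (mul_nonneg hr.le hsin0) _)]
      refine Real.rpow_le_rpow (mul_nonneg hr.le hsin0) ?_ (by linarith)
      rw [← le_div_iff₀' hr]
      exact Real.sin_le hθ.1
    rw [norm_mul, norm_mul, norm_mul, mul_comm (s ^ _)]
    refine mul_le_mul ?_ h2 (norm_nonneg _) (Real.exp_pos _).le
    refine le_trans (mul_le_of_le_one_right (by positivity) (abs_gegenbauerCos_le_one α hα y _)) ?_
    exact (mul_le_of_le_one_right (by positivity) (abs_gegenbauerCos_le_one α hα x _)).trans h1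
  · rw [rescaledIntegrand, Set.indicator_of_notMem hmem, norm_zero]
    exact hbound

/-- Local limit theorem for the random walk, at the diffusive scale. -/
theorem tendsto_sqrt_mul_nStep (α : ℝ) (hα : -1 / 2 ≤ α) (μ : PMF ℕ) (hμ : IsAperiodic α μ)
    (hmom : Summable fun n : ℕ => (μ n).toReal * (n : ℝ) ^ 2) {M N : ℕ → ℕ} {u v : ℝ} (hv : 0 < v)
    (hM : Tendsto (fun n : ℕ => (M n : ℝ) / √(n : ℝ)) atTop (nhds u))
    (hN : Tendsto (fun n : ℕ => (N n : ℝ) / √(n : ℝ)) atTop (nhds v)) :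
    Tendsto (fun n : ℕ => √(n : ℝ) * nStep α hα μ n (M n) (N n)) atTop
      (nhds (v ^ (2 * α + 1) / (2 ^ (2 * α + 1) * diffConst α μ ^ (α + 1) * Real.Gamma (α + 1))
        * Real.exp (-(u ^ 2 + v ^ 2) / (4 * diffConst α μ))
        * normBessel (α + 1) ((u * v / (4 * diffConst α μ)) ^ 2))) := by
  have hC := diffConst_pos α hα μ hμ hmom
  obtain ⟨c, hc0, hc⟩ := exists_abs_transform_le_exp α hα μ hμ hmom
  have hsq : Tendsto (fun n : ℕ => √(n : ℝ)) atTop atTop :=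
    Real.tendsto_sqrt_atTop.comp tendsto_natCast_atTop_atTop
  have hlim : Tendsto (fun n => ∫ s in Set.Ioi (0 : ℝ), rescaledIntegrand α μ n (M n) (N n) s) atTop
      (nhds (∫ s in Set.Ioi (0 : ℝ), Real.exp (-diffConst α μ * s ^ 2)
        * normBessel (α + 1) (-(u * s) ^ 2 / 4) * normBessel (α + 1) (-(v * s) ^ 2 / 4)
        * s ^ (2 * (α + 1) - 1))) := by
    rw [show 2 * (α + 1) - 1 = 2 * α + 1 by ring]
    refine MeasureTheory.tendsto_integral_of_dominated_convergence
      (fun s => s ^ (2 * α + 1) * Real.exp (-c * s ^ 2)) (fun n => ?_)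
      (integrableOn_rpow_mul_exp_neg_mul_sq hc0 (by linarith)) (fun n => ?_) ?_
    · have ct := continuous_transform α hα μ
      have cx := continuous_gegenbauerCos α (M n)
      have cy := continuous_gegenbauerCos α (N n)
      have cw : Continuous fun s : ℝ => (√(n : ℝ) * Real.sin (s / √(n : ℝ))) ^ (2 * α + 1) :=
        Continuous.rpow_const (by fun_prop) fun _ => Or.inr (by linarith)
      exact (Measurable.indicator (Continuous.measurable (by fun_prop))
        measurableSet_Ioc).aestronglyMeasurable
    · exact MeasureTheory.ae_restrict_of_forall_mem measurableSet_Ioi fun s hs =>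
        norm_rescaledIntegrand_le α hα μ hc n _ _ hs
    · exact MeasureTheory.ae_restrict_of_forall_mem measurableSet_Ioi fun s hs =>
        tendsto_rescaledIntegrand α hα μ hmom hM hN hs
  rw [integral_weber (by linarith : 1 / 2 ≤ α + 1) hC] at hlim
  -- Here `v > 0` matters: the growth of the inverse norm applies only if the end point goes to
  -- infinity. The starting point may stay bounded.
  have hNtop : Tendsto N atTop atTop := by
    have h1 : Tendsto (fun n => (N n : ℝ)) atTop atTop := by
      refine (hN.pos_mul_atTop hv hsq).congr' ?_
      filter_upwards [eventually_gt_atTop 0] with n hn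
      have hr : 0 < √(n : ℝ) := Real.sqrt_pos.2 (by exact_mod_cast hn)
      exact div_mul_cancel₀ _ hr.ne'
    exact tendsto_natCast_atTop_iff.1 h1
  have h2 := (((tendsto_inv_sqNorm α hα).comp hNtop).mul
    (hN.rpow_const (p := 2 * α + 1) (Or.inl hv.ne'))).mul hlim
  have e : 2 / (2 ^ (2 * α + 1) * Real.Gamma (α + 1) ^ 2) * v ^ (2 * α + 1)
      * (Real.Gamma (α + 1) / (2 * diffConst α μ ^ (α + 1))
        * (Real.exp (-(u ^ 2 + v ^ 2) / (4 * diffConst α μ))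
          * normBessel (α + 1) ((u * v / (4 * diffConst α μ)) ^ 2)))
      = v ^ (2 * α + 1) / (2 ^ (2 * α + 1) * diffConst α μ ^ (α + 1) * Real.Gamma (α + 1))
        * Real.exp (-(u ^ 2 + v ^ 2) / (4 * diffConst α μ))
        * normBessel (α + 1) ((u * v / (4 * diffConst α μ)) ^ 2) := by
    have hG : 0 < Real.Gamma (α + 1) := Real.Gamma_pos_of_pos (by linarith)
    have hCp := Real.rpow_pos_of_pos hC (α + 1)
    have h2p : (0 : ℝ) < 2 ^ (2 * α + 1) := Real.rpow_pos_of_pos two_pos _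
    field_simp
  rw [e] at h2
  refine h2.congr' ?_
  filter_upwards [eventually_gt_atTop 0, hNtop.eventually_gt_atTop 0] with n hn hNn
  exact (sqrt_mul_nStep_eq α hα μ hn (M n) hNn).symm

/-! ### Identification with `I_α` and conclusion. -/

theorem normBessel_zero (a : ℝ) : normBessel a 0 = 1 := by
  rw [normBessel, tsum_eq_single 0 fun k hk => by simp [hk]]
  simp [rising]

theorem normBessel_pos {a z : ℝ} (ha : 1 / 2 ≤ a) (hz : 0 ≤ z) : 0 < normBessel a z := by
  have h : ∀ k : ℕ, 0 ≤ z ^ k / ((k.factorial : ℝ) * rising a k) := fun k => by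
    have := rising_pos (by linarith : 0 < a) k
    positivity
  refine (summable_norm_normBessel ha z).of_norm.tsum_pos h 0 ?_
  simp [rising]

theorem besselI_two_mul (α : ℝ) (hα : -1 < α) {z : ℝ} (hz : 0 < z) :
    besselI α (2 * z) = z ^ α / Real.Gamma (α + 1) * normBessel (α + 1) (z ^ 2) := by
  rw [besselI, normBessel, ← tsum_mul_left]
  congr 1
  funext k
  rw [mul_div_cancel_left₀ z two_ne_zero, show (k : ℝ) + α + 1 = α + 1 + k by ring,
    Gamma_add_natCast (by linarith), Real.rpow_add hz, ← pow_mul,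
    show 2 * (k : ℝ) = ((2 * k : ℕ) : ℝ) by push_cast; ring, Real.rpow_natCast,
    div_mul_div_comm]
  congr 1 <;> ring

theorem tendsto_floor_mul_sqrt_div {x : ℝ} (hx : 0 ≤ x) :
    Tendsto (fun n : ℕ => (⌊x * √(n : ℝ)⌋₊ : ℝ) / √(n : ℝ)) atTop (nhds x) :=
  (tendsto_nat_floor_mul_div_atTop hx).comp
    (Real.tendsto_sqrt_atTop.comp tendsto_natCast_atTop_atTop)

end GegenbauerWalk

theorem theorem4p4 (α : ℝ) (hα : -1 / 2 ≤ α) (μ : PMF ℕ)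
    (hμ : GegenbauerWalk.IsAperiodic α μ)
    (hmom : Summable fun n : ℕ => (μ n).toReal * (n : ℝ) ^ 2)
    (x : ℝ) (hx : 0 < x) :
    ((fun n : ℕ => √(n : ℝ) *
        GegenbauerWalk.nStep α hα μ n ⌊x * √(n : ℝ)⌋₊ ⌊x * √(n : ℝ)⌋₊)
      ~[atTop] fun _ : ℕ =>
        x / (2 * GegenbauerWalk.diffConst α μ)
          * Real.exp (-(x ^ 2 / (2 * GegenbauerWalk.diffConst α μ)))
          * GegenbauerWalk.besselI α (x ^ 2 / (2 * GegenbauerWalk.diffConst α μ))) ∧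
    ((fun n : ℕ => √(n : ℝ) * GegenbauerWalk.nStep α hα μ n 0 ⌊x * √(n : ℝ)⌋₊)
      ~[atTop] fun _ : ℕ =>
        x ^ (2 * α + 1) * Real.exp (-(x ^ 2 / (4 * GegenbauerWalk.diffConst α μ)))
          / ((2 : ℝ) ^ (2 * α + 1) * GegenbauerWalk.diffConst α μ ^ (α + 1)
            * Real.Gamma (α + 1))) := by
  have hC := GegenbauerWalk.diffConst_pos α hα μ hμ hmom
  have hN := GegenbauerWalk.tendsto_floor_mul_sqrt_div hx.le
  have hG : 0 < Real.Gamma (α + 1) := Real.Gamma_pos_of_pos (by linarith)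
  have hxp := Real.rpow_pos_of_pos hx (2 * α + 1)
  have h2p : (0 : ℝ) < 2 ^ (2 * α + 1) := Real.rpow_pos_of_pos two_pos _
  constructor
  · have h := GegenbauerWalk.tendsto_sqrt_mul_nStep α hα μ hμ hmom hx hN hN
    generalize GegenbauerWalk.diffConst α μ = D at hC h ⊢
    have hCp := Real.rpow_pos_of_pos hC (α + 1)
    have hz : 0 < x ^ 2 / (4 * D) := by positivity
    have hB := GegenbauerWalk.normBessel_pos (a := α + 1) (z := (x ^ 2 / (4 * D)) ^ 2)
      (by linarith) (by positivity)
    have e1 : x / (2 * D) * Real.exp (-(x ^ 2 / (2 * D)))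
          * GegenbauerWalk.besselI α (x ^ 2 / (2 * D))
        = x ^ (2 * α + 1) / (2 ^ (2 * α + 1) * D ^ (α + 1) * Real.Gamma (α + 1))
        * Real.exp (-(x ^ 2 + x ^ 2) / (4 * D))
        * GegenbauerWalk.normBessel (α + 1) ((x * x / (4 * D)) ^ 2) := by
      -- With `z = x²/(4D)` the Bessel argument is `2z`; the factor `z^α` and the prefactor `x/(2D)`
      -- combine to `x^{2α+1} / (2^{2α+1} D^{α+1})`.
      rw [show x ^ 2 / (2 * D) = 2 * (x ^ 2 / (4 * D)) by field_simp; ring,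
        GegenbauerWalk.besselI_two_mul α (by linarith) hz,
        show -(x ^ 2 + x ^ 2) / (4 * D) = -(2 * (x ^ 2 / (4 * D))) by field_simp; ring,
        ← sq x, Real.div_rpow (by positivity) (by positivity),
        Real.mul_rpow (by norm_num) hC.le, show (4 : ℝ) = 2 ^ (2 : ℝ) by norm_num,
        ← Real.rpow_mul two_pos.le, ← Real.rpow_two x, ← Real.rpow_mul hx.le,
        Real.rpow_add_one hx.ne', Real.rpow_add_one two_ne_zero, Real.rpow_add_one hC.ne']
      field_simp
    rw [e1]
    -- Convergence gives equivalence only for a nonzero limit, hence the positivity of `normBessel`.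
    refine (isEquivalent_const_iff_tendsto ?_).2 h
    rw [← sq x]
    positivity
  · have h := GegenbauerWalk.tendsto_sqrt_mul_nStep α hα μ hμ hmom (M := fun _ => 0) (u := 0) hx
      (by simp) hN
    generalize GegenbauerWalk.diffConst α μ = D at hC h ⊢
    have hCp := Real.rpow_pos_of_pos hC (α + 1)
    rw [zero_mul, zero_div, zero_pow two_ne_zero, GegenbauerWalk.normBessel_zero, mul_one, zero_add,
      neg_div, div_mul_eq_mul_div] at h
    refine (isEquivalent_const_iff_tendsto ?_).2 h
    positivity
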